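/- Let $\mathscr A=\{1,\dots,k\}$ be a finite alphabet, partitioned into two nonempty sets $\mathscr A_{\rm sing}$ and $\mathscr A_{\rm inv}$, let $p=(p_1,\dots,p_k)$ be a probability vector with all $p_i>0$, and let $\mu=p^{\mathbb Z}$ be the Bernoulli measure on $X=\mathscr A^{\mathbb Z}$. Let $\mathcal M^*$ be the set of tuples $(A_1,\dots,A_k)$ of real $2\times 2$ matrices such that $\operatorname{rank}A_i=1$ for $i\in\mathscr A_{\rm sing}$, $\det A_j>0$ for $j\in\mathscr A_{\rm inv}$, and $\operatorname{Range}(A_i)\neq\operatorname{Ker}(A_j)$ for all $i,j\in\mathscr A_{\rm sing}$. Let $\Lambda\subset\mathbb R$ be a compact interval of positive length and let $t\mapsto A_t=(A_t(1),\dots,A_t(k))\in\mathcal M^*$ be a $C^\infty$ map on $\Lambda$ such that (A1) for each $i\in\mathscr A_{\rm sing}$ the matrix $A_t(i)$ does not depend on $t$; (A2) there is $\kappa>0$ such that $\dfrac{A_t(j)v\wedge \frac{d}{dt}A_t(j)v}{\|A_t(j)v\|^2}\ge\kappa$ for all $t\in\Lambda$, $j\in\mathscr A_{\rm inv}$ and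 $v\in\mathbb R^2\setminus\{0\}$, where $v\wedge w=v_1w_2-v_2w_1$. For $\omega\in X$ put $A_t^n(\omega)=A_t(\omega_n)\cdots A_t(\omega_1)$, and let $L_1(A_t)\in[-\infty,\infty)$ be the $\mu$-almost sure limit of $\frac1n\log\|A^n_t(\omega)\|$, where $\|\cdot\|$ is the Euclidean norm or the associated operator norm and $\log 0=-\infty$. An invertible matrix acts on the projective line $\mathbb P^1$ in the usual way, and a rank one matrix acts as the constant map to its range; write $\hat A$ for this action. Let $\eta_t$ be the unique probability measure on $\mathbb P^1$ that is stationary for the Markov operator $\mathcal Q_t\varphi(\hat v)=\sum_i p_i\,\varphi(\hat A_t(i)\hat v)$ on bounded measurable functions, explicitly $$\eta_t=\sum_{s\in\mathscr A_{\rm sing}}p_s\sum_{n\ge0}\ \sum_{(\omega_1,\dots,\omega_n)\in\mathscr A_{\rm inv}^n}p_{\omega_1}\cdots p_{\omega_n}\,\delta_{\hat A_t(\omega_n)\cdots\hat A_t(\omega_1)\hat r_s},$$ where $\hat r_s$ is the range of $A_t(s)$, and let $\tilde\eta$ be the measure on $\Lambda\times\mathbb P^1$ with $\int\phi\,d\tilde\eta=\int_\Lambda\int_{\mathbb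 P^1}\phi(t,\hat v)\,d\eta_t(\hat v)\,dt$. Then for every $\epsilon>0$ there is $c_0(\epsilon)>0$, depending on $\epsilon$, $p$ and the family but not on $t$, $\hat v$ or $n$, such that the following hold. (1) For every $\epsilon>0$ and $\tilde\eta$-a.e. $(t,\hat v)$ there is $n_0(\epsilon,t,\hat v)\in\mathbb N$ such that for all $n\ge n_0(\epsilon,t,\hat v)$, with $v$ a unit vector on the line $\hat v$, $$\mu\Big\{\omega\in X:\Big|\tfrac1n\log\|A_t^n(\omega)v\|-L_1(A_t)\Big|>\epsilon\Big\}<e^{-c_0(\epsilon)\,n^{1/3}}.$$ (2) For Lebesgue-a.e. $t\in\Lambda$ and every $\epsilon>0$ there is $n_0(\epsilon,t)\in\mathbb N$ such that for all $n\ge n_0(\epsilon,t)$, $$\mu\Big\{\omega\in X:\Big|\tfrac1n\log\|A_t^n(\omega)\|-L_1(A_t)\Big|>\epsilon\Big\}<e^{-c_0(\epsilon)\,n^{1/3}}.$$ Here an absolute value $|{\pm\infty}|$ counts as exceeding $\epsilon$, so (1) and (2) include that $L_1(A_t)$ is finite for a.e. $t$. -/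

import Mathlib

open MeasureTheory Filter Topology Set
open scoped ENNReal LinearAlgebra.Projectivization

namespace RandomCocycle

noncomputable section

/-! ### The plane, the projective line, and the projective action of a matrix -/

/-- Real `2 × 2` matrices. -/
abbrev Mat2 := Matrix (Fin 2) (Fin 2) ℝ

/-- The Euclidean plane. -/
abbrev Plane := EuclideanSpace ℝ (Fin 2)

/-- The projective line `ℙ(ℝ²)`. -/
abbrev P1 := ℙ ℝ Plane

/-- The Borel structure of the projective line, as the quotient of `ℝ² ∖ {0}`. -/
instance instMeasurableSpaceP1 : MeasurableSpace P1 :=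
  MeasurableSpace.map (Projectivization.mk' ℝ) inferInstance

/-- The linear operator of the Euclidean plane given by a matrix; its norm is the
operator norm, i.e. the largest singular value. -/
def linMap (M : Mat2) : Plane →L[ℝ] Plane :=
  Matrix.toEuclideanCLM (n := Fin 2) (𝕜 := ℝ) M

/-- The area form `v ∧ w` of the plane. -/
def wedge (v w : Plane) : ℝ := v 0 * w 1 - v 1 * w 0

/-- The range of a rank one matrix, as a point of the projective line
(an arbitrary point if the matrix is zero). -/
def rangeDir (M : Mat2) : P1 :=
  open scoped Classical in
  if h : ∃ u : Plane, linMap M u ≠ 0 then Projectivization.mk ℝ (linMap M h.choose) h.choose_spec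
  else Classical.arbitrary P1

/-- The projective action: the induced map for an invertible matrix, and the constant map
to the range for a singular one. -/
def projAct (M : Mat2) (v : P1) : P1 :=
  open scoped Classical in
  if h : Function.Injective (linMap M) then
    Projectivization.map (linMap M : Plane →ₗ[ℝ] Plane) h v
  else rangeDir M

/-! ### Cocycles -/

variable {k : ℕ}

/-- The cocycles whose components are of rank one for the letters in `S`, have positive
determinant for the other letters, and for which no range `r_i` equals a kernel `k_j`,
`i, j ∈ S`. -/
def MStar (S : Finset (Fin k)) : Set (Fin k → Mat2) :=
  {B | (∀ i ∈ S, (B i).rank = 1) ∧ (∀ j ∉ S, 0 < (B j).det) ∧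
    ∀ i ∈ S, ∀ j ∈ S,
      LinearMap.range (linMap (B i) : Plane →ₗ[ℝ] Plane) ≠
        LinearMap.ker (linMap (B j) : Plane →ₗ[ℝ] Plane)}

/-- The product `B (w_n) ⋯ B (w_1)` along a word `w = (w_1, …, w_n)`. -/
def wordProd (B : Fin k → Mat2) : (n : ℕ) → (Fin n → Fin k) → Mat2
  | 0, _ => 1
  | n + 1, w => B (w (Fin.last n)) * wordProd B n (Fin.init w)

/-- The fiber iterate `B^n(ω) = B (ω_n) ⋯ B (ω_1)` over a bi-infinite sequence `ω`. -/
def iterate (B : Fin k → Mat2) (n : ℕ) (ω : ℤ → Fin k) : Mat2 :=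
  wordProd B n (fun j => ω ((j : ℤ) + 1))

/-- The Bernoulli measure `p^ℤ`. -/
def bernoulliMeasure (p : PMF (Fin k)) : Measure (ℤ → Fin k) :=
  Measure.infinitePi (fun _ : ℤ => p.toMeasure)

/-- `(1/n) log ‖B^n(ω)‖`, with `log 0 = -∞`. -/
def normGrowth (B : Fin k → Mat2) (n : ℕ) (ω : ℤ → Fin k) : EReal :=
  ENNReal.log ‖linMap (iterate B n ω)‖ₑ / (n : EReal)

/-- `(1/n) log ‖B^n(ω) v‖` for a unit vector `v` on the line `x`, with `log 0 = -∞`. -/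
def vectorGrowth (B : Fin k → Mat2) (n : ℕ) (ω : ℤ → Fin k) (x : P1) : EReal :=
  ENNReal.log (‖linMap (iterate B n ω) x.rep‖ₑ / ‖x.rep‖ₑ) / (n : EReal)

/-- `L` is the almost sure limit of `(1/n) log ‖B^n(ω)‖`. -/
def IsTopLyapunov (p : PMF (Fin k)) (B : Fin k → Mat2) (L : EReal) : Prop :=
  ∀ᵐ ω ∂(bernoulliMeasure p), Tendsto (fun n : ℕ => normGrowth B n ω) atTop (𝓝 L)

/-- The first Lyapunov exponent `L₁(B) ∈ [-∞, ∞)`: the almost sure limit of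
`(1/n) log ‖B^n(ω)‖`. -/
def topLyapunov (p : PMF (Fin k)) (B : Fin k → Mat2) : EReal :=
  open scoped Classical in
  if h : ∃ L : EReal, IsTopLyapunov p B L then h.choose else ⊥

/-! ### Stationary measures -/

/-- The Markov operator `(Q φ)(v) = ∑ i, p_i φ(B̂_i v)`. -/
def markovOp (p : PMF (Fin k)) (B : Fin k → Mat2) (φ : P1 → ℝ) (v : P1) : ℝ :=
  ∑ i, (p i).toReal * φ (projAct (B i) v)

/-- Stationary probability measures of the Markov operator. -/
def IsStationary (p : PMF (Fin k)) (B : Fin k → Mat2) (η : Measure P1) : Prop :=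
  IsProbabilityMeasure η ∧
    ∀ φ : P1 → ℝ, Measurable φ → (∃ C : ℝ, ∀ v, |φ v| ≤ C) →
      ∫ v, markovOp p B φ v ∂η = ∫ v, φ v ∂η

/-- The stationary measure of a cocycle with singular letters `S`,
`η = ∑_{s ∈ S} p_s ∑_n ∑_{w ∈ (Sᶜ)^n} p(w) δ_{B̂^n(w) r̂_s}`. It is the unique stationary
probability measure, see `isStationary_iff` below. -/
def stationaryMeasure (p : PMF (Fin k)) (S : Finset (Fin k)) (B : Fin k → Mat2) : Measure P1 :=
  Measure.sum fun n : ℕ => ∑ s ∈ S, ∑ w : Fin n → {i : Fin k // i ∉ S},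
    (p s * ∏ j, p (w j)) •
      Measure.dirac (projAct (wordProd B n (fun j => (w j : Fin k))) (rangeDir (B s)))

/-- The measure `η̃` on `[a, b] × ℙ¹` whose disintegration over Lebesgue measure is the family
of the stationary measures of the `A t`, see `etaTilde_apply` below. -/
def etaTilde (p : PMF (Fin k)) (S : Finset (Fin k)) (A : ℝ → Fin k → Mat2) (a b : ℝ) :
    Measure (ℝ × P1) :=
  (volume.restrict (Icc a b)).bind
    (fun t => (stationaryMeasure p S (A t)).map (Prod.mk t))

/-! ### The measures are what they should be -/

theorem topLyapunov_eq {p : PMF (Fin k)} {B : Fin k → Mat2} {L : EReal}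
    (h : IsTopLyapunov p B L) : topLyapunov p B = L := by
  have hex : ∃ L : EReal, IsTopLyapunov p B L := ⟨L, h⟩
  rw [topLyapunov, dif_pos hex]
  have hprob : IsProbabilityMeasure (bernoulliMeasure p) := by
    unfold bernoulliMeasure; infer_instance
  obtain ⟨ω, h1, h2⟩ := (hex.choose_spec.and h).exists
  exact tendsto_nhds_unique h1 h2

theorem measurable_mk' : Measurable (Projectivization.mk' ℝ : {v : Plane // v ≠ 0} → P1) :=
  fun _ hs => hs

theorem measurable_projAct (M : Mat2) : Measurable (projAct M) := by
  by_cases h : Function.Injective (linMap M)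
  · intro s hs
    have hg : Measurable (fun v : {v : Plane // v ≠ 0} =>
        (⟨linMap M v, fun c => v.2 (h (by simp [c]))⟩ : {v : Plane // v ≠ 0})) :=
      ((linMap M).continuous.measurable.comp measurable_subtype_coe).subtype_mk
    have := hg (measurable_mk' hs)
    change MeasurableSet (Projectivization.mk' ℝ ⁻¹' (projAct M ⁻¹' s))
    convert this using 1
    ext v
    simp only [mem_preimage, projAct, dif_pos h]
    rfl
  · have : projAct M = fun _ => rangeDir M := by
      funext v; simp [projAct, h]
    rw [this]; exact measurable_const

theorem linMap_mul (M N : Mat2) (v : Plane) : linMap (M * N) v = linMap M (linMap N v) := by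
  simp [linMap]

theorem projAct_mul {M N : Mat2} (hM : Function.Injective (linMap M))
    (hN : Function.Injective (linMap N)) (v : P1) :
    projAct (M * N) v = projAct M (projAct N v) := by
  have hMN : Function.Injective (linMap (M * N)) := by
    intro x y hxy
    rw [linMap_mul, linMap_mul] at hxy
    exact hN (hM hxy)
  obtain ⟨u, hu, rfl⟩ : ∃ u hu, v = Projectivization.mk ℝ u hu :=
    ⟨v.rep, v.rep_nonzero, v.mk_rep.symm⟩
  simp only [projAct, dif_pos hM, dif_pos hN, dif_pos hMN, Projectivization.map_mk]
  congr 1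
  exact linMap_mul M N u

theorem injective_linMap_of_det {M : Mat2} (h : M.det ≠ 0) :
    Function.Injective (linMap M) := by
  have hu : IsUnit M := (Matrix.isUnit_iff_isUnit_det M).2 (isUnit_iff_ne_zero.2 h)
  obtain ⟨N, hN⟩ := hu.exists_left_inv
  intro x y hxy
  have := congrArg (linMap N) hxy
  rw [← linMap_mul, ← linMap_mul, hN] at this
  simpa [linMap] using this

theorem not_injective_linMap_of_rank {M : Mat2} (h : M.rank = 1) :
    ¬ Function.Injective (linMap M) := by
  intro hinj
  have hM : IsUnit M := by
    rw [← Matrix.mulVec_injective_iff_isUnit]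
    intro x y hxy
    have : linMap M (WithLp.toLp 2 x) = linMap M (WithLp.toLp 2 y) := by
      simp only [linMap, Matrix.toEuclideanCLM_toLp, hxy]
    simpa using hinj this
  have := Matrix.rank_of_isUnit M hM
  simp [h] at this

theorem linMap_wordProd_injective {B : Fin k → Mat2} {S : Finset (Fin k)}
    (hI : ∀ j ∉ S, Function.Injective (linMap (B j))) :
    ∀ (n : ℕ) (w : Fin n → {i : Fin k // i ∉ S}),
      Function.Injective (linMap (wordProd B n (fun j => (w j : Fin k)))) := by
  intro n
  induction n with
  | zero => intro w x y h; simpa [wordProd, linMap] using h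
  | succ n ih =>
    intro w x y h
    simp only [wordProd, linMap_mul] at h
    exact ih (Fin.init w) (hI _ (w (Fin.last n)).2 h)

/-- The weight given to a set by the words of length `n`. -/
def layer (p : PMF (Fin k)) (S : Finset (Fin k)) (B : Fin k → Mat2) (n : ℕ) : Measure P1 :=
  ∑ s ∈ S, ∑ w : Fin n → {i : Fin k // i ∉ S},
    (p s * ∏ j, p (w j)) •
      Measure.dirac (projAct (wordProd B n (fun j => (w j : Fin k))) (rangeDir (B s)))

theorem layer_apply (p : PMF (Fin k)) (S : Finset (Fin k)) (B : Fin k → Mat2) (n : ℕ)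
    {E : Set P1} (hE : MeasurableSet E) :
    layer p S B n E = ∑ s ∈ S, ∑ w : Fin n → {i : Fin k // i ∉ S},
      (p s * ∏ j, p (w j)) *
        E.indicator 1 (projAct (wordProd B n (fun j => (w j : Fin k))) (rangeDir (B s))) := by
  simp [layer, Measure.finsetSum_apply, Measure.dirac_apply' _ hE]

theorem layer_succ {p : PMF (Fin k)} {S : Finset (Fin k)} {B : Fin k → Mat2}
    (hI : ∀ j ∉ S, Function.Injective (linMap (B j))) (n : ℕ)
    {E : Set P1} (hE : MeasurableSet E) :
    layer p S B (n + 1) E =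
      ∑ i : {i : Fin k // i ∉ S}, p i * layer p S B n (projAct (B i) ⁻¹' E) := by
  have hE' : ∀ i, MeasurableSet (projAct (B i) ⁻¹' E) := fun i => measurable_projAct (B i) hE
  simp only [layer_apply p S B _ hE, layer_apply p S B _ (hE' _), Finset.mul_sum]
  conv_rhs => rw [Finset.sum_comm]
  refine Finset.sum_congr rfl fun s _ => ?_
  rw [← (Fin.snocEquiv (fun _ : Fin (n + 1) => {i : Fin k // i ∉ S})).sum_comp,
    Fintype.sum_prod_type]
  refine Finset.sum_congr rfl fun i _ => Finset.sum_congr rfl fun w _ => ?_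
  have h1 : wordProd B (n + 1) (fun j => ((Fin.snocEquiv
      (fun _ : Fin (n + 1) => {i : Fin k // i ∉ S})) (i, w) j : Fin k))
      = B i * wordProd B n (fun j => (w j : Fin k)) := by
    simp only [wordProd]
    congr 2
    · simp [Fin.snocEquiv]
    · funext j; simp [Fin.snocEquiv, Fin.init]
  rw [h1, projAct_mul (hI _ i.2) (linMap_wordProd_injective hI n w), Fin.prod_univ_castSucc]
  simp only [Fin.snocEquiv, Equiv.coe_fn_mk, Fin.snoc_castSucc, Fin.snoc_last]
  rw [← mul_assoc, ← mul_assoc, ← indicator_comp_right]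
  simp only [Function.comp_def, Pi.one_apply]
  have : (fun _ : P1 => (1 : ℝ≥0∞)) = 1 := rfl
  rw [this]
  congr 1
  ring

theorem layer_zero (p : PMF (Fin k)) (S : Finset (Fin k)) {B : Fin k → Mat2}
    {E : Set P1} (hE : MeasurableSet E) :
    layer p S B 0 E = ∑ s ∈ S, p s * E.indicator 1 (rangeDir (B s)) := by
  rw [layer_apply p S B 0 hE]
  refine Finset.sum_congr rfl fun s _ => ?_
  have hinj : Function.Injective (linMap (1 : Mat2)) := by
    intro x y h; simpa [linMap] using h
  have : projAct (1 : Mat2) (rangeDir (B s)) = rangeDir (B s) := by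
    generalize rangeDir (B s) = v
    obtain ⟨u, hu, rfl⟩ : ∃ u hu, v = Projectivization.mk ℝ u hu :=
      ⟨v.rep, v.rep_nonzero, v.mk_rep.symm⟩
    simp only [projAct, dif_pos hinj, Projectivization.map_mk]
    congr 1
    simp [linMap]
  simp [wordProd, this]

theorem sum_split (S : Finset (Fin k)) (f : Fin k → ℝ≥0∞) :
    ∑ i, f i = ∑ s ∈ S, f s + ∑ i : {i : Fin k // i ∉ S}, f i := by
  classical
  rw [← Finset.sum_add_sum_compl S f]
  congr 1
  exact (Finset.sum_subtype _ (by simp) f)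

theorem stationaryMeasure_apply (p : PMF (Fin k)) (S : Finset (Fin k)) (B : Fin k → Mat2)
    {E : Set P1} (hE : MeasurableSet E) :
    stationaryMeasure p S B E = ∑' n, layer p S B n E := by
  rw [stationaryMeasure, Measure.sum_apply _ hE]; rfl

theorem stationaryMeasure_fixed {p : PMF (Fin k)} {S : Finset (Fin k)} {B : Fin k → Mat2}
    (hI : ∀ j ∉ S, Function.Injective (linMap (B j))) {E : Set P1} (hE : MeasurableSet E) :
    stationaryMeasure p S B E = ∑ s ∈ S, p s * E.indicator 1 (rangeDir (B s)) +
      ∑ i : {i : Fin k // i ∉ S}, p i * stationaryMeasure p S B (projAct (B i) ⁻¹' E) := by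
  rw [stationaryMeasure_apply p S B hE, tsum_eq_zero_add' ENNReal.summable, layer_zero p S hE]
  congr 1
  simp only [layer_succ hI _ hE, stationaryMeasure_apply p S B (measurable_projAct _ hE)]
  rw [Summable.tsum_finsetSum (fun _ _ => ENNReal.summable)]
  simp only [ENNReal.tsum_mul_left]

theorem isProbabilityMeasure_stationaryMeasure {p : PMF (Fin k)} {S : Finset (Fin k)}
    {B : Fin k → Mat2} (hp : ∀ i, 0 < p i) (hS : ∃ i, i ∈ S)
    (hI : ∀ j ∉ S, Function.Injective (linMap (B j))) :
    IsProbabilityMeasure (stationaryMeasure p S B) := by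
  constructor
  set q : ℝ≥0∞ := ∑ s ∈ S, p s with hq
  set r : ℝ≥0∞ := ∑ i : {i : Fin k // i ∉ S}, p i with hr
  have hqr : q + r = 1 := by
    have h1 := p.tsum_coe
    rw [tsum_fintype] at h1
    rw [hq, hr, ← sum_split S (fun i => p i), h1]
  have hq0 : q ≠ 0 := by
    obtain ⟨i, hi⟩ := hS
    have := Finset.single_le_sum (f := fun s => p s) (fun _ _ => zero_le) hi
    exact (lt_of_lt_of_le (hp i) this).ne'
  have hr1 : r ≤ 1 := hqr ▸ le_add_self
  have hl : ∀ n, layer p S B n univ = q * r ^ n := by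
    intro n
    induction n with
    | zero => rw [layer_zero p S MeasurableSet.univ]; simp [hq]
    | succ n ih =>
      rw [layer_succ hI n MeasurableSet.univ]
      simp only [preimage_univ, ih]
      rw [← Finset.sum_mul, pow_succ]
      ring
  rw [stationaryMeasure_apply p S B MeasurableSet.univ]
  simp only [hl]
  rw [ENNReal.tsum_mul_left, ENNReal.tsum_geometric]
  have h1 : 1 - r = q := by
    rw [← hqr]
    exact ENNReal.add_sub_cancel_right (ne_top_of_le_ne_top ENNReal.one_ne_top hr1)
  rw [h1]
  exact ENNReal.mul_inv_cancel hq0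
    (ne_top_of_le_ne_top ENNReal.one_ne_top (hqr ▸ le_self_add))

theorem isStationary_iff_fixed {p : PMF (Fin k)} {B : Fin k → Mat2} {η : Measure P1}
    [IsProbabilityMeasure η] :
    IsStationary p B η ↔
      ∀ E, MeasurableSet E → η E = ∑ i, p i * η (projAct (B i) ⁻¹' E) := by
  have hpt : ∀ i, p i ≠ ∞ := p.apply_ne_top
  constructor
  · rintro ⟨-, h⟩ E hE
    have h1 := h (E.indicator 1) (measurable_one.indicator hE)
      ⟨1, fun v => by by_cases hv : v ∈ E <;> simp [hv]⟩
    rw [integral_indicator_one hE] at h1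
    have h2 : ∫ v, markovOp p B (E.indicator 1) v ∂η
        = ∑ i, (p i).toReal * η.real (projAct (B i) ⁻¹' E) := by
      simp only [markovOp]
      have hf : ∀ i, (fun v => (E.indicator (1 : P1 → ℝ)) (projAct (B i) v))
          = (projAct (B i) ⁻¹' E).indicator 1 := by
        intro i; funext v
        by_cases hv : projAct (B i) v ∈ E
        · rw [indicator_of_mem hv, indicator_of_mem (show v ∈ projAct (B i) ⁻¹' E from hv)]; rfl
        · rw [indicator_of_notMem hv,
            indicator_of_notMem (show v ∉ projAct (B i) ⁻¹' E from hv)]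
      rw [integral_finsetSum]
      · refine Finset.sum_congr rfl fun i _ => ?_
        rw [integral_const_mul, hf, integral_indicator_one (measurable_projAct _ hE)]
      · intro i _
        refine Integrable.const_mul ?_ _
        rw [hf]
        exact (integrable_const (1 : ℝ)).indicator (measurable_projAct _ hE)
    rw [h2] at h1
    rw [← ENNReal.toReal_eq_toReal_iff' (measure_ne_top _ _)
      (ENNReal.sum_ne_top.2 fun i _ => ENNReal.mul_ne_top (hpt i) (measure_ne_top _ _)),
      ENNReal.toReal_sum (fun i _ => ENNReal.mul_ne_top (hpt i) (measure_ne_top _ _))]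
    simp only [ENNReal.toReal_mul]
    exact h1.symm
  · intro h
    refine ⟨inferInstance, fun φ hφ hb => ?_⟩
    obtain ⟨C, hC⟩ := hb
    have hη : η = ∑ i, p i • η.map (projAct (B i)) := by
      ext E hE
      rw [h E hE]
      simp [Measure.finsetSum_apply, Measure.map_apply (measurable_projAct _) hE]
    have hint : ∀ i, Integrable (fun v => φ (projAct (B i) v)) η := fun i =>
      Integrable.of_bound (hφ.comp (measurable_projAct _)).aestronglyMeasurable C
        (ae_of_all _ fun v => hC _)
    have hint' : ∀ i, Integrable φ (p i • η.map (projAct (B i))) := by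
      intro i
      have : IsProbabilityMeasure (η.map (projAct (B i))) :=
        Measure.isProbabilityMeasure_map (measurable_projAct _).aemeasurable
      exact (Integrable.of_bound hφ.aestronglyMeasurable C
        (ae_of_all _ fun v => hC _)).smul_measure (hpt i)
    conv_rhs => rw [hη]
    rw [integral_finsetSum_measure (fun i _ => hint' i)]
    simp only [markovOp]
    rw [integral_finsetSum _ (fun i _ => (hint i).const_mul _)]
    refine Finset.sum_congr rfl fun i _ => ?_
    rw [integral_const_mul, integral_smul_measure,
      integral_map (measurable_projAct _).aemeasurable hφ.aestronglyMeasurable]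
    rfl

/-- For a cocycle in `MStar S`, `stationaryMeasure p S B` is the unique stationary probability
measure of the Markov operator. -/
theorem isStationary_iff {p : PMF (Fin k)} {S : Finset (Fin k)} {B : Fin k → Mat2}
    (hp : ∀ i, 0 < p i) (hS : ∃ i, i ∈ S) (hB : B ∈ MStar S) (ν : Measure P1) :
    IsStationary p B ν ↔ ν = stationaryMeasure p S B := by
  have hI : ∀ j ∉ S, Function.Injective (linMap (B j)) := fun j hj =>
    injective_linMap_of_det (hB.2.1 j hj).ne'
  have hN : ∀ i ∈ S, ∀ v, projAct (B i) v = rangeDir (B i) := by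
    intro i hi v
    simp [projAct, not_injective_linMap_of_rank (hB.1 i hi)]
  have hprob := isProbabilityMeasure_stationaryMeasure hp hS hI
  have hsing : ∀ (ν : Measure P1) [IsProbabilityMeasure ν] (E : Set P1), ∀ i ∈ S,
      ν (projAct (B i) ⁻¹' E) = E.indicator 1 (rangeDir (B i)) := by
    intro ν _ E i hi
    by_cases h : rangeDir (B i) ∈ E
    · have : projAct (B i) ⁻¹' E = univ := by
        ext v; simp [hN i hi v, h]
      simp [this, h]
    · have : projAct (B i) ⁻¹' E = ∅ := by
        ext v; simp [hN i hi v, h]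
      simp [this, h]
  have hsplit : ∀ (ν : Measure P1) [IsProbabilityMeasure ν] (E : Set P1),
      ∑ i, p i * ν (projAct (B i) ⁻¹' E) = ∑ s ∈ S, p s * E.indicator 1 (rangeDir (B s)) +
        ∑ i : {i : Fin k // i ∉ S}, p i * ν (projAct (B i) ⁻¹' E) := by
    intro ν _ E
    rw [sum_split S]
    congr 1
    exact Finset.sum_congr rfl fun i hi => by rw [hsing ν E i hi]
  constructor
  · intro h
    have : IsProbabilityMeasure ν := h.1
    rw [isStationary_iff_fixed] at h
    set η := stationaryMeasure p S B with hη
    set r : ℝ := ∑ i : {i : Fin k // i ∉ S}, (p i).toReal with hr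
    have hr0 : 0 ≤ r := Finset.sum_nonneg fun _ _ => ENNReal.toReal_nonneg
    have hr1 : r < 1 := by
      have h1 : ∑ i, (p i).toReal = 1 := by
        have h1 := p.tsum_coe
        rw [tsum_fintype] at h1
        rw [← ENNReal.toReal_sum (fun i _ => p.apply_ne_top i), h1, ENNReal.toReal_one]
      obtain ⟨i, hi⟩ := hS
      have h2 : 0 < ∑ s ∈ S, (p s).toReal :=
        Finset.sum_pos (fun s _ => ENNReal.toReal_pos (hp s).ne' (p.apply_ne_top s)) ⟨i, hi⟩
      have h3 : ∑ s ∈ S, (p s).toReal + r = 1 := by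
        classical
        rw [← h1, ← Finset.sum_add_sum_compl S (fun i => (p i).toReal), hr]
        congr 1
        exact (Finset.sum_subtype Sᶜ (fun _ => Finset.mem_compl) (fun i => (p i).toReal)).symm
      linarith
    have hreal : ∀ (ν : Measure P1) [IsProbabilityMeasure ν] (E : Set P1),
        ν E = ∑ s ∈ S, p s * E.indicator 1 (rangeDir (B s)) +
          ∑ i : {i : Fin k // i ∉ S}, p i * ν (projAct (B i) ⁻¹' E) →
        ν.real E = (∑ s ∈ S, p s * E.indicator 1 (rangeDir (B s))).toReal +
          ∑ i : {i : Fin k // i ∉ S}, (p i).toReal * ν.real (projAct (B i) ⁻¹' E) := by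
      intro ν _ E h
      have hf : ∀ i : {i : Fin k // i ∉ S}, p i * ν (projAct (B i) ⁻¹' E) ≠ ∞ := fun i =>
        ENNReal.mul_ne_top (p.apply_ne_top i) (measure_ne_top _ _)
      have hf' : ∑ s ∈ S, p s * E.indicator 1 (rangeDir (B s)) ≠ ∞ :=
        ENNReal.sum_ne_top.2 fun s _ => ENNReal.mul_ne_top (p.apply_ne_top s) (by
          by_cases h : rangeDir (B s) ∈ E <;> simp [h])
      rw [measureReal_def, h, ENNReal.toReal_add hf' (ENNReal.sum_ne_top.2 fun i _ => hf i),
        ENNReal.toReal_sum (fun i _ => hf i)]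
      simp only [ENNReal.toReal_mul, measureReal_def]
    have key : ∀ n : ℕ, ∀ E, MeasurableSet E → |ν.real E - η.real E| ≤ r ^ n := by
      intro n
      induction n with
      | zero =>
        intro E hE
        rw [pow_zero, abs_le]
        constructor <;>
        linarith [measureReal_nonneg (μ := ν) (s := E), measureReal_nonneg (μ := η) (s := E),
          measureReal_le_one (μ := ν) (s := E), measureReal_le_one (μ := η) (s := E)]
      | succ n ih =>
        intro E hE
        rw [hreal ν E ((h E hE).trans (hsplit ν E)),
          hreal η E (stationaryMeasure_fixed hI hE), add_sub_add_left_eq_sub,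
          ← Finset.sum_sub_distrib]
        refine (Finset.abs_sum_le_sum_abs _ _).trans ?_
        rw [pow_succ, mul_comm, hr, Finset.sum_mul]
        refine Finset.sum_le_sum fun i _ => ?_
        rw [← mul_sub, abs_mul, abs_of_nonneg ENNReal.toReal_nonneg]
        exact mul_le_mul_of_nonneg_left (ih _ (measurable_projAct _ hE)) ENNReal.toReal_nonneg
    ext E hE
    have hlim := tendsto_pow_atTop_nhds_zero_of_lt_one hr0 hr1
    have h0 : |ν.real E - η.real E| ≤ 0 :=
      ge_of_tendsto' hlim fun n => key n E hE
    have h1 : ν.real E = η.real E := by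
      have := abs_nonpos_iff.1 h0
      linarith
    exact (ENNReal.toReal_eq_toReal_iff' (measure_ne_top _ _) (measure_ne_top _ _)).1 h1
  · rintro rfl
    rw [isStationary_iff_fixed]
    intro E hE
    rw [hsplit, stationaryMeasure_fixed hI hE]

/-- If the singular components are constant and the others are continuous in `t ∈ [a, b]`, then
`etaTilde` is the measure with disintegration `t ↦ stationaryMeasure p S (A t)` over Lebesgue
measure on `[a, b]`. -/
theorem etaTilde_apply {p : PMF (Fin k)} {S : Finset (Fin k)} {A : ℝ → Fin k → Mat2} {a b : ℝ}
    (hM : ∀ t ∈ Icc a b, A t ∈ MStar S)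
    (hcont : ∀ i x y, ContinuousOn (fun t => A t i x y) (Icc a b))
    (hconst : ∀ i ∈ S, ∀ t ∈ Icc a b, ∀ t' ∈ Icc a b, A t i = A t' i)
    {E : Set (ℝ × P1)} (hE : MeasurableSet E) :
    etaTilde p S A a b E =
      ∫⁻ t in Icc a b, stationaryMeasure p S (A t) (Prod.mk t ⁻¹' E) := by
  rcases (Icc a b).eq_empty_or_nonempty with hemp | ⟨t₀, ht₀⟩
  · simp [etaTilde, hemp]
  have hI : ∀ t ∈ Icc a b, ∀ j ∉ S, Function.Injective (linMap (A t j)) := fun t ht j hj =>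
    injective_linMap_of_det ((hM t ht).2.1 j hj).ne'
  have hword : ∀ (n : ℕ) (w : Fin n → Fin k) (x y : Fin 2),
      ContinuousOn (fun t => wordProd (A t) n w x y) (Icc a b) := by
    intro n
    induction n with
    | zero => intro w x y; exact continuousOn_const
    | succ n ih =>
      intro w x y
      simp only [wordProd, Matrix.mul_apply]
      exact continuousOn_finsetSum _ fun z _ => (hcont _ x z).mul (ih _ z y)
  have hpt : ∀ (n : ℕ) (s : Fin k), s ∈ S → ∀ (w : Fin n → {i : Fin k // i ∉ S}),
      AEMeasurable (fun t => projAct (wordProd (A t) n (fun j => (w j : Fin k)))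
        (rangeDir (A t s))) (volume.restrict (Icc a b)) := by
    intro n s hs w
    refine aemeasurable_restrict_of_measurable_subtype measurableSet_Icc ?_
    set v : Plane := (rangeDir (A t₀ s)).rep with hv
    have hinj : ∀ t : Icc a b,
        Function.Injective (linMap (wordProd (A t) n (fun j => (w j : Fin k)))) := fun t =>
      linMap_wordProd_injective (hI t t.2) n w
    have hne : ∀ t : Icc a b, linMap (wordProd (A t) n (fun j => (w j : Fin k))) v ≠ 0 := by
      intro t h0
      exact (rangeDir (A t₀ s)).rep_nonzero (hinj t (by rw [← hv, h0, map_zero]))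
    have heq : (fun t : Icc a b => projAct (wordProd (A t) n (fun j => (w j : Fin k)))
        (rangeDir (A t s))) = fun t : Icc a b => Projectivization.mk' ℝ
          ⟨linMap (wordProd (A t.1) n (fun j => (w j : Fin k))) v, hne t⟩ := by
      funext t
      rw [hconst s hs t t.2 t₀ ht₀, ← (rangeDir (A t₀ s)).mk_rep]
      simp only [projAct, dif_pos (hinj t), Projectivization.map_mk]
      rfl
    rw [heq]
    refine measurable_mk'.comp (Measurable.subtype_mk ?_)
    refine Continuous.measurable ?_
    simp only [linMap]
    have : ∀ M : Mat2, Matrix.toEuclideanCLM (n := Fin 2) (𝕜 := ℝ) M v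
        = WithLp.toLp 2 (M.mulVec (WithLp.ofLp v)) := fun M => by
      rw [← Matrix.toEuclideanCLM_toLp]
    simp only [this]
    refine (PiLp.continuous_toLp 2 _).comp (continuous_pi fun x => ?_)
    simp only [Matrix.mulVec, dotProduct]
    exact continuous_finsetSum _ fun y _ =>
      ((continuousOn_iff_continuous_domRestrict.1 (hword n _ x y))).mul continuous_const
  have hmeas : AEMeasurable (fun t => (stationaryMeasure p S (A t)).map (Prod.mk t))
      (volume.restrict (Icc a b)) := by
    have hex : ∀ (n : ℕ) (s : Fin k) (w : Fin n → {i : Fin k // i ∉ S}), ∃ g : ℝ → P1,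
        Measurable g ∧ (s ∈ S → ∀ᵐ t ∂(volume.restrict (Icc a b)),
          projAct (wordProd (A t) n (fun j => (w j : Fin k))) (rangeDir (A t s)) = g t) := by
      intro n s w
      by_cases hs : s ∈ S
      · exact ⟨_, (hpt n s hs w).measurable_mk, fun _ => (hpt n s hs w).ae_eq_mk⟩
      · exact ⟨fun _ => Classical.arbitrary P1, measurable_const, fun h => absurd h hs⟩
    choose g hg hge using hex
    refine ⟨fun t => (Measure.sum fun n : ℕ => ∑ s ∈ S, ∑ w : Fin n → {i : Fin k // i ∉ S},
      (p s * ∏ j, p (w j)) • Measure.dirac (g n s w t)).map (Prod.mk t), ?_, ?_⟩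
    · refine Measure.measurable_of_measurable_coe _ fun F hF => ?_
      have hF' : ∀ t : ℝ, MeasurableSet (Prod.mk t ⁻¹' F) := fun t => measurable_prodMk_left hF
      simp only [Measure.map_apply measurable_prodMk_left hF, Measure.sum_apply _ (hF' _),
        Measure.finsetSum_apply, Measure.smul_apply, Measure.dirac_apply' _ (hF' _), smul_eq_mul]
      refine Measurable.tsum fun n => Finset.measurable_fun_sum _ fun s _ =>
        Finset.measurable_fun_sum _ fun w _ => Measurable.const_mul ?_ _
      exact (measurable_one.indicator hF).comp (measurable_id.prodMk (hg n s w))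
    · have hall : ∀ᵐ t ∂(volume.restrict (Icc a b)), ∀ n, ∀ s ∈ S,
          ∀ w : Fin n → {i : Fin k // i ∉ S},
          projAct (wordProd (A t) n (fun j => (w j : Fin k))) (rangeDir (A t s)) = g n s w t := by
        rw [ae_all_iff]; intro n
        rw [ae_all_iff]; intro s
        rw [ae_all_iff]; intro hs
        rw [ae_all_iff]; intro w
        exact hge n s w hs
      filter_upwards [hall] with t ht
      refine congrArg (Measure.map (Prod.mk t)) (congrArg Measure.sum (funext fun n => ?_))
      refine Finset.sum_congr rfl fun s hs => Finset.sum_congr rfl fun w _ => ?_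
      rw [ht n s hs w]
  rw [etaTilde, Measure.bind_apply hE hmeas]
  refine lintegral_congr fun t => ?_
  rw [Measure.map_apply measurable_prodMk_left hE]

end

end RandomCocycle

open RandomCocycle

/-!
Between two singular letters the cocycle is a product of invertible matrices applied to the range
of a singular letter, and at every singular letter it forgets its direction. So it splits into
excursions: a word in invertible letters of geometric length, closed by a singular letter. For a
fixed parameter, the logarithmic growth over an excursion has exponential moments as soon as
`E ‖·‖ ^ (-α) < ∞` for some `α > 0`. Then the growth satisfies an exponential large deviation
estimate with a rate that depends on the parameter. Whatever this rate is, the estimate beats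
`exp (-n ^ (1/3))` for all `n` from some parameter dependent `n₀` on, so the constant `c₀ = 1`
serves for all parameters.

The negative moments are finite for almost every parameter because of the winding condition: the
image of the range `r` under a nonempty word turns with positive speed in `t`, so a functional `φ`
evaluated along it satisfies `f' g - f g' ≥ κ ‖φ‖ ^ 2 ‖u‖ ^ 2` with the conjugate functional `g`.
Integrating the derivative of a regularization of `f |f| ^ (-1/2) g` bounds `∫ |f| ^ (-1/2) dt`
exponentially in the length of the word (`lintegral_rpow_neg_half_le`,
`exists_lintegral_pairing_le`); a small power of this exponential is absorbed by the geometric law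
of the length (`exists_ae_lintegral_image_ne_top`). The empty word is covered by the condition that
no range is a kernel.

The large deviations for a fixed parameter come from a function `h` on the plane, homogeneous of a
small degree `± θ`, that is superharmonic for the transfer operator up to the factor
`exp (θ (± L + ε))` (`exists_drift`). It is the expected total cost until the next singular letter,
`drift`; the condition to check is that the expected cost over one excursion does not exceed the
value at its beginning, and this is the inequality `mgf < 1` for a variable of negative mean
(`HasExpMoment.mgf_lt_one`). Markov's inequality for `h` gives both deviations for vectors on the
orbits of the singular ranges, where `h` is finite, and the upper deviation for all vectors, hence
both for the norm. By the Borel–Cantelli lemma `L` is the Lyapunov exponent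
(`topLyapunov_eq_of_decaysExp`), and almost every point of `etaTilde` lies on such an orbit
(`ae_etaTilde`).
-/

namespace RandomCocycle

variable {k : ℕ}

/-! ### Transfer operators -/

/-- The operator `f ↦ ∑ i, q i * f (B i ·)` on functions of a vector; the weights `q` need not
have total mass one. -/
noncomputable def transfer (q : Fin k → ℝ≥0∞) (B : Fin k → Mat2) (f : Plane → ℝ≥0∞) (u : Plane) :
    ℝ≥0∞ :=
  ∑ i, q i * f (linMap (B i) u)

theorem transfer_mono {q : Fin k → ℝ≥0∞} {B : Fin k → Mat2} {f g : Plane → ℝ≥0∞}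
    (h : ∀ u, f u ≤ g u) (u : Plane) : transfer q B f u ≤ transfer q B g u :=
  Finset.sum_le_sum fun _ _ => mul_le_mul_right (h _) _

theorem transfer_const_mul (q : Fin k → ℝ≥0∞) (B : Fin k → Mat2) (c : ℝ≥0∞) (f : Plane → ℝ≥0∞)
    (u : Plane) : transfer q B (fun v => c * f v) u = c * transfer q B f u := by
  simp only [transfer, Finset.mul_sum]
  exact Finset.sum_congr rfl fun _ _ => by ring

theorem sum_snoc {n : ℕ} (F : (Fin (n + 1) → Fin k) → ℝ≥0∞) :
    ∑ w, F w = ∑ w : Fin n → Fin k, ∑ i : Fin k, F (Fin.snoc (α := fun _ => Fin k) w i) := by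
  rw [← (Fin.snocEquiv (fun _ : Fin (n + 1) => Fin k)).sum_comp, Fintype.sum_prod_type,
    Finset.sum_comm]
  rfl

theorem wordProd_snoc (B : Fin k → Mat2) {n : ℕ} (w : Fin n → Fin k) (i : Fin k) :
    wordProd B (n + 1) (Fin.snoc (α := fun _ => Fin k) w i) = B i * wordProd B n w := by
  simp [wordProd]

theorem prod_snoc (q : Fin k → ℝ≥0∞) {n : ℕ} (w : Fin n → Fin k) (i : Fin k) :
    ∏ j, q (Fin.snoc (α := fun _ => Fin k) w i j) = (∏ j, q (w j)) * q i := by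
  simp [Fin.prod_univ_castSucc]

theorem linMap_one (u : Plane) : linMap 1 u = u := by simp [linMap]

theorem transfer_iterate_apply (q : Fin k → ℝ≥0∞) (B : Fin k → Mat2) (n : ℕ)
    (f : Plane → ℝ≥0∞) (u : Plane) :
    (transfer q B)^[n] f u =
      ∑ w : Fin n → Fin k, (∏ j, q (w j)) * f (linMap (wordProd B n w) u) := by
  induction n generalizing f with
  | zero => simp [wordProd, linMap_one]
  | succ n ih =>
    rw [Function.iterate_succ_apply, ih, sum_snoc]
    refine Finset.sum_congr rfl fun w _ => ?_
    simp only [transfer, Finset.mul_sum, prod_snoc, wordProd_snoc, linMap_mul, mul_assoc]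

/-- The Green potential `∑ n, c ^ n T ^ n ψ` of the transfer operator `T`. -/
noncomputable def potential (q : Fin k → ℝ≥0∞) (B : Fin k → Mat2) (c : ℝ≥0∞) (ψ : Plane → ℝ≥0∞)
    (u : Plane) : ℝ≥0∞ :=
  ∑' n : ℕ, c ^ n * (transfer q B)^[n] ψ u

theorem potential_eq (q : Fin k → ℝ≥0∞) (B : Fin k → Mat2) (c : ℝ≥0∞) (ψ : Plane → ℝ≥0∞)
    (u : Plane) :
    potential q B c ψ u = ψ u + c * transfer q B (potential q B c ψ) u := by
  rw [potential, tsum_eq_zero_add' ENNReal.summable]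
  simp only [pow_zero, one_mul, Function.iterate_zero, id_eq]
  congr 1
  have h : transfer q B (potential q B c ψ) u =
      ∑' n : ℕ, c ^ n * (transfer q B)^[n + 1] ψ u := by
    rw [transfer]
    simp only [potential, ← ENNReal.tsum_mul_left]
    rw [← Summable.tsum_finsetSum (fun _ _ => ENNReal.summable)]
    refine tsum_congr fun n => ?_
    rw [Function.iterate_succ_apply', transfer, Finset.mul_sum]
    exact Finset.sum_congr rfl fun _ _ => by ring
  rw [h, ← ENNReal.tsum_mul_left]
  exact tsum_congr fun n => by ring

/-- Homogeneity of degree `e` along nonzero scalars. -/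
def IsHomogeneous (e : ℝ) (f : Plane → ℝ≥0∞) : Prop :=
  ∀ a : ℝ, a ≠ 0 → ∀ u, f (a • u) = ‖a‖ₑ ^ e * f u

theorem IsHomogeneous.transfer {e : ℝ} {f : Plane → ℝ≥0∞} (hf : IsHomogeneous e f)
    (q : Fin k → ℝ≥0∞) (B : Fin k → Mat2) : IsHomogeneous e (transfer q B f) := by
  intro a ha u
  simp only [RandomCocycle.transfer, Finset.mul_sum, map_smul]
  refine Finset.sum_congr rfl fun i _ => ?_
  rw [hf a ha]; ring

theorem IsHomogeneous.potential {e : ℝ} {ψ : Plane → ℝ≥0∞} (hψ : IsHomogeneous e ψ)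
    (q : Fin k → ℝ≥0∞) (B : Fin k → Mat2) (c : ℝ≥0∞) :
    IsHomogeneous e (potential q B c ψ) := by
  have h : ∀ n, IsHomogeneous e ((RandomCocycle.transfer q B)^[n] ψ) := by
    intro n
    induction n with
    | zero => exact hψ
    | succ n ih => rw [Function.iterate_succ_apply']; exact ih.transfer q B
  intro a ha u
  simp only [RandomCocycle.potential, ← ENNReal.tsum_mul_left]
  refine tsum_congr fun n => ?_
  rw [h n a ha]; ring

theorem enorm_smul_rpow (e a : ℝ) (u : Plane) :
    ‖a • u‖ₑ ^ e = ‖a‖ₑ ^ e * ‖u‖ₑ ^ e := by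
  rw [enorm_smul, ENNReal.mul_rpow_of_ne_top enorm_ne_top enorm_ne_top]

theorem potential_zero {q : Fin k → ℝ≥0∞} {B : Fin k → Mat2} {c : ℝ≥0∞} {ψ : Plane → ℝ≥0∞}
    (hψ : ψ 0 = 0) : potential q B c ψ 0 = 0 := by
  simp only [potential, ENNReal.tsum_eq_zero]
  intro n
  simp [transfer_iterate_apply, hψ]

/-- Weights of the invertible letters. -/
noncomputable def invWeight (p : PMF (Fin k)) (S : Finset (Fin k)) (i : Fin k) : ℝ≥0∞ :=
  if i ∈ S then 0 else p i

/-- Weights of the singular letters. -/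
noncomputable def singWeight (p : PMF (Fin k)) (S : Finset (Fin k)) (i : Fin k) : ℝ≥0∞ :=
  if i ∈ S then p i else 0

theorem invWeight_add_singWeight (p : PMF (Fin k)) (S : Finset (Fin k)) (i : Fin k) :
    invWeight p S i + singWeight p S i = p i := by
  by_cases h : i ∈ S <;> simp [invWeight, singWeight, h]

theorem transfer_split (p : PMF (Fin k)) (S : Finset (Fin k)) (B : Fin k → Mat2)
    (f : Plane → ℝ≥0∞) (u : Plane) :
    transfer p B f u = transfer (invWeight p S) B f u + transfer (singWeight p S) B f u := by
  simp only [transfer, ← Finset.sum_add_distrib, ← add_mul, invWeight_add_singWeight]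

/-- The contribution to the drift function of the letter read after a run of invertible letters:
either it is singular and the cocycle restarts with weight `H`, or the word stops here. -/
noncomputable def exitCost (p : PMF (Fin k)) (S : Finset (Fin k)) (B : Fin k → Mat2) (c γ : ℝ≥0∞)
    (e : ℝ) (H : Fin k → ℝ≥0∞) (u : Plane) : ℝ≥0∞ :=
  c * ∑ i, singWeight p S i * (‖linMap (B i) u‖ₑ ^ e * H i) + γ * ‖u‖ₑ ^ e

/-- The drift function of degree `e`: the potential, for the invertible letters only, of the
exit cost. -/
noncomputable def drift (p : PMF (Fin k)) (S : Finset (Fin k)) (B : Fin k → Mat2) (c γ : ℝ≥0∞)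
    (e : ℝ) (H : Fin k → ℝ≥0∞) : Plane → ℝ≥0∞ :=
  potential (invWeight p S) B c (exitCost p S B c γ e H)

section Drift

variable {p : PMF (Fin k)} {S : Finset (Fin k)} {B : Fin k → Mat2} {c γ : ℝ≥0∞} {e : ℝ}
  {H : Fin k → ℝ≥0∞}

theorem isHomogeneous_exitCost : IsHomogeneous e (exitCost p S B c γ e H) := by
  intro a _ u
  simp only [exitCost, map_smul, enorm_smul_rpow, mul_add, Finset.mul_sum]
  congr 1
  · exact Finset.sum_congr rfl fun i _ => by ring
  · ring

theorem le_drift (u : Plane) : γ * ‖u‖ₑ ^ e ≤ drift p S B c γ e H u := by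
  rw [drift, potential_eq, exitCost, add_assoc, add_left_comm]
  exact le_self_add

theorem drift_smul_le (he : e ≠ 0) (hγ : γ ≠ 0) {r : Plane} (hr : ‖r‖ = 1) (a : ℝ) :
    drift p S B c γ e H (a • r) ≤ ‖a‖ₑ ^ e * drift p S B c γ e H r := by
  rcases eq_or_ne a 0 with rfl | ha
  · rcases lt_or_gt_of_ne he with he' | he'
    · have h1 : drift p S B c γ e H r ≠ 0 := by
        refine (lt_of_lt_of_le (pos_iff_ne_zero.2 hγ) ?_).ne'
        refine le_trans (le_of_eq ?_) (le_drift r)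
        have : ‖r‖ₑ = 1 := by rw [← ofReal_norm, hr, ENNReal.ofReal_one]
        rw [this, ENNReal.one_rpow, mul_one]
      rw [enorm_zero, ENNReal.zero_rpow_of_neg he', ENNReal.top_mul h1]
      exact le_top
    · rw [zero_smul, drift, potential_zero]
      · exact zero_le
      · simp [exitCost, ENNReal.zero_rpow_of_pos he']
  · exact (isHomogeneous_exitCost.potential _ _ _ a ha r).le

/-- If the expected value of the drift function over an excursion between two singular letters
does not exceed `H`, then the drift function is superharmonic for the full transfer operator:
a singular letter sends every vector to a multiple of its range, where the value `H` is available
to pay for the restart. -/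
theorem transfer_drift_le (he : e ≠ 0) (hγ : γ ≠ 0) {r : Fin k → Plane}
    (hr : ∀ i ∈ S, ‖r i‖ = 1) (hB : ∀ i ∈ S, ∀ u, ∃ a : ℝ, linMap (B i) u = a • r i)
    (hH : ∀ i ∈ S, drift p S B c γ e H (r i) ≤ H i) (u : Plane) :
    c * transfer p B (drift p S B c γ e H) u ≤ drift p S B c γ e H u := by
  have key : transfer (singWeight p S) B (drift p S B c γ e H) u ≤
      ∑ i, singWeight p S i * (‖linMap (B i) u‖ₑ ^ e * H i) := by
    refine Finset.sum_le_sum fun i _ => ?_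
    by_cases hi : i ∈ S
    · refine mul_le_mul_right ?_ _
      obtain ⟨a, ha⟩ := hB i hi u
      have h1 : ‖r i‖ₑ = 1 := by rw [← ofReal_norm, hr i hi, ENNReal.ofReal_one]
      rw [ha, enorm_smul, h1, mul_one]
      exact (drift_smul_le he hγ (hr i hi) a).trans (mul_le_mul_right (hH i hi) _)
    · simp [singWeight, hi]
  calc c * transfer p B (drift p S B c γ e H) u
      = c * transfer (singWeight p S) B (drift p S B c γ e H) u +
          c * transfer (invWeight p S) B (drift p S B c γ e H) u := by
        rw [transfer_split p S, mul_add, add_comm]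
    _ ≤ exitCost p S B c γ e H u +
          c * transfer (invWeight p S) B (drift p S B c γ e H) u := by
        gcongr
        exact (mul_le_mul_right key c).trans le_self_add
    _ = drift p S B c γ e H u := (potential_eq _ _ _ _ _).symm

end Drift

theorem transfer_iterate_le {q : Fin k → ℝ≥0∞} {B : Fin k → Mat2} {c : ℝ≥0∞}
    {h : Plane → ℝ≥0∞} (hh : ∀ u, c * transfer q B h u ≤ h u) (n : ℕ) (u : Plane) :
    c ^ n * (transfer q B)^[n] h u ≤ h u := by
  induction n generalizing u with
  | zero => simp
  | succ n ih =>
    rw [Function.iterate_succ_apply', pow_succ', mul_assoc, ← transfer_const_mul]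
    exact (mul_le_mul_right (transfer_mono ih u) c).trans (hh u)

/-- Finiteness of a superharmonic function propagates along orbits. -/
theorem superharmonic_ne_top {q : Fin k → ℝ≥0∞} {B : Fin k → Mat2} {c : ℝ≥0∞} (hc : c ≠ 0)
    {h : Plane → ℝ≥0∞} (hh : ∀ u, c * transfer q B h u ≤ h u) {u : Plane} (hu : h u ≠ ∞)
    {n : ℕ} (w : Fin n → Fin k) (hw : ∀ j, q (w j) ≠ 0) :
    h (linMap (wordProd B n w) u) ≠ ∞ := by
  have h1 := transfer_iterate_le hh n u
  rw [transfer_iterate_apply] at h1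
  have h2 : c ^ n * ((∏ j, q (w j)) * h (linMap (wordProd B n w) u)) ≤ h u :=
    (mul_le_mul_right (Finset.single_le_sum (f := fun w : Fin n → Fin k =>
      (∏ j, q (w j)) * h (linMap (wordProd B n w) u)) (fun _ _ => zero_le)
      (Finset.mem_univ w)) _).trans h1
  intro h3
  rw [h3, ENNReal.mul_top (Finset.prod_ne_zero_iff.2 fun j _ => hw j),
    ENNReal.mul_top (pow_ne_zero n hc)] at h2
  exact hu (top_le_iff.1 h2)

/-! ### From words to the Bernoulli measure -/

theorem bernoulliMeasure_cylinder (p : PMF (Fin k)) {n : ℕ} (w : Fin n → Fin k) :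
    bernoulliMeasure p {ω | (fun j : Fin n => ω ((j : ℤ) + 1)) = w} = ∏ j, p (w j) := by
  classical
  let f : Fin n ↪ ℤ := ⟨fun j => (j : ℤ) + 1, fun i j h => by
    have : (i : ℤ) = j := by simpa using h
    exact Fin.ext (by exact_mod_cast this)⟩
  have hset : {ω : ℤ → Fin k | (fun j : Fin n => ω ((j : ℤ) + 1)) = w} =
      ((Finset.univ.map f : Finset ℤ) : Set ℤ).pi
        (fun z => {x | ∀ j, f j = z → x = w j}) := by
    ext ω
    simp only [mem_ofPred_eq, funext_iff, Set.mem_pi, Finset.coe_map, Finset.coe_univ, image_univ,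
      mem_range, forall_exists_index]
    constructor
    · rintro h z j rfl i hi
      rw [← h i]
      exact congrArg ω hi.symm
    · intro h j
      exact h _ j rfl j rfl
  rw [hset, bernoulliMeasure, Measure.infinitePi_pi _ (fun _ _ => MeasurableSet.of_discrete),
    Finset.prod_map]
  refine Finset.prod_congr rfl fun j _ => ?_
  have : {x : Fin k | ∀ i, f i = f j → x = w i} = {w j} := by
    ext x
    simp only [mem_ofPred_eq, mem_singleton_iff, f.injective.eq_iff, forall_eq]
  rw [this, PMF.toMeasure_apply_singleton _ _ (MeasurableSet.singleton _)]

/-- Markov's inequality for a superharmonic function. -/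
theorem bernoulliMeasure_le_of_superharmonic {p : PMF (Fin k)} {B : Fin k → Mat2} {c : ℝ≥0∞}
    {h : Plane → ℝ≥0∞} (hh : ∀ u, c * transfer p B h u ≤ h u) (n : ℕ) (u : Plane) (K : ℝ≥0∞) :
    c ^ n * (K * bernoulliMeasure p {ω | K ≤ h (linMap (iterate B n ω) u)}) ≤ h u := by
  classical
  refine le_trans (mul_le_mul_right ?_ _) (transfer_iterate_le hh n u)
  set bad := Finset.univ.filter fun w : Fin n → Fin k => K ≤ h (linMap (wordProd B n w) u)
  have hsub : {ω | K ≤ h (linMap (iterate B n ω) u)} ⊆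
      ⋃ w ∈ bad, {ω : ℤ → Fin k | (fun j : Fin n => ω ((j : ℤ) + 1)) = w} := by
    intro ω hω
    simp only [mem_iUnion]
    exact ⟨_, Finset.mem_filter.2 ⟨Finset.mem_univ _, hω⟩, rfl⟩
  calc K * bernoulliMeasure p {ω | K ≤ h (linMap (iterate B n ω) u)}
      ≤ K * ∑ w ∈ bad, ∏ j, p (w j) := by
        refine mul_le_mul_right ((measure_mono hsub).trans
          ((measure_biUnion_finset_le _ _).trans (le_of_eq ?_))) _
        exact Finset.sum_congr rfl fun w _ => bernoulliMeasure_cylinder p w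
    _ ≤ ∑ w ∈ bad, (∏ j, p (w j)) * h (linMap (wordProd B n w) u) := by
        rw [Finset.mul_sum]
        refine Finset.sum_le_sum fun w hw => ?_
        rw [mul_comm]
        exact mul_le_mul_right (Finset.mem_filter.1 hw).2 _
    _ ≤ (transfer p B)^[n] h u := by
        rw [transfer_iterate_apply]
        exact Finset.sum_le_univ_sum_of_nonneg fun _ => zero_le

/-! ### Exponential moments -/

section ExpMoment

variable {Ω : Type*} [MeasurableSpace Ω] {μ : Measure Ω}

/-- A random variable with a finite exponential moment on both sides. -/
def HasExpMoment (X : Ω → ℝ) (μ : Measure Ω) : Prop :=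
  Measurable X ∧ ∃ α > 0, Integrable (fun ω => Real.exp (α * |X ω|)) μ

theorem HasExpMoment.add {X Y : Ω → ℝ} (hX : HasExpMoment X μ) (hY : HasExpMoment Y μ) :
    HasExpMoment (fun ω => X ω + Y ω) μ := by
  obtain ⟨hXm, α, hα, hXi⟩ := hX
  obtain ⟨hYm, β, hβ, hYi⟩ := hY
  refine ⟨hXm.add hYm, min α β / 2, by positivity, ?_⟩
  refine (hXi.add hYi).mono' (by fun_prop) (Eventually.of_forall fun ω => ?_)
  rw [Real.norm_eq_abs, abs_of_pos (Real.exp_pos _), Pi.add_apply]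
  have hδ : 0 < min α β := lt_min hα hβ
  have h1 : |X ω + Y ω| ≤ |X ω| + |Y ω| := abs_add_le _ _
  have hα' : min α β * |X ω| ≤ α * |X ω| :=
    mul_le_mul_of_nonneg_right (min_le_left _ _) (abs_nonneg _)
  have hβ' : min α β * |Y ω| ≤ β * |Y ω| :=
    mul_le_mul_of_nonneg_right (min_le_right _ _) (abs_nonneg _)
  rcases le_total (|X ω|) (|Y ω|) with h | h
  · refine le_trans (Real.exp_le_exp.2 ?_) (le_add_of_nonneg_left (Real.exp_pos _).le)
    nlinarith
  · refine le_trans (Real.exp_le_exp.2 ?_) (le_add_of_nonneg_right (Real.exp_pos _).le)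
    nlinarith

theorem HasExpMoment.const_mul {X : Ω → ℝ} (hX : HasExpMoment X μ) (a : ℝ) :
    HasExpMoment (fun ω => a * X ω) μ := by
  obtain ⟨hXm, α, hα, hXi⟩ := hX
  refine ⟨hXm.const_mul a, α / (|a| + 1), by positivity, ?_⟩
  refine hXi.mono' (by fun_prop) (Eventually.of_forall fun ω => ?_)
  rw [Real.norm_eq_abs, abs_of_pos (Real.exp_pos _), Real.exp_le_exp, abs_mul, div_mul_eq_mul_div,
    div_le_iff₀ (by positivity)]
  nlinarith [mul_nonneg hα.le (abs_nonneg (X ω)), abs_nonneg a]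

theorem hasExpMoment_of_bounded [IsFiniteMeasure μ] {X : Ω → ℝ} (hX : Measurable X) {C : ℝ}
    (h : ∀ ω, |X ω| ≤ C) : HasExpMoment X μ := by
  refine ⟨hX, 1, one_pos, ?_⟩
  refine (integrable_const (Real.exp C)).mono' (by fun_prop) (Eventually.of_forall fun ω => ?_)
  rw [Real.norm_eq_abs, abs_of_pos (Real.exp_pos _), Real.exp_le_exp, one_mul]
  exact h ω

theorem HasExpMoment.exists_integrable {X : Ω → ℝ} (hX : HasExpMoment X μ) :
    ∃ α > 0, ∀ t, |t| ≤ α → Integrable (fun ω => Real.exp (t * X ω)) μ := by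
  obtain ⟨hXm, α, hα, hXi⟩ := hX
  refine ⟨α, hα, fun t ht => ?_⟩
  refine hXi.mono' (by fun_prop) (Eventually.of_forall fun ω => ?_)
  rw [Real.norm_eq_abs, abs_of_pos (Real.exp_pos _), Real.exp_le_exp]
  exact (le_abs_self _).trans (by rw [abs_mul]; gcongr)

theorem HasExpMoment.integrable {X : Ω → ℝ} (hX : HasExpMoment X μ) : Integrable X μ := by
  obtain ⟨hXm, α, hα, hXi⟩ := hX
  refine (hXi.const_mul α⁻¹).mono' hXm.aestronglyMeasurable (Eventually.of_forall fun ω => ?_)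
  rw [Real.norm_eq_abs, ← div_eq_inv_mul, le_div_iff₀ hα]
  linarith [Real.add_one_le_exp (α * |X ω|)]

/-- A variable with exponential moments and negative mean has moment generating function below
`1` just to the right of the origin. -/
theorem HasExpMoment.mgf_lt_one [IsProbabilityMeasure μ] {X : Ω → ℝ} (hX : HasExpMoment X μ)
    (hneg : ∫ ω, X ω ∂μ < 0) :
    ∀ᶠ θ in 𝓝[>] (0 : ℝ), Integrable (fun ω => Real.exp (θ * X ω)) μ ∧
      ∫ ω, Real.exp (θ * X ω) ∂μ < 1 := by
  obtain ⟨α, hα, hint⟩ := hX.exists_integrable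
  have h0 : (0 : ℝ) ∈ interior (ProbabilityTheory.integrableExpSet X μ) := by
    refine mem_interior.2 ⟨Ioo (-α) α, fun t ht => hint t (abs_le.2 ⟨ht.1.le, ht.2.le⟩),
      isOpen_Ioo, by constructor <;> linarith⟩
  have hd := ProbabilityTheory.hasDerivAt_mgf h0
  simp only [zero_mul, Real.exp_zero, mul_one] at hd
  have hs := (hasDerivAt_iff_tendsto_slope.1 hd).mono_left
    (nhdsWithin_mono 0 (fun x (hx : 0 < x) => (hx.ne' : x ≠ 0)))
  have h1 : ∀ᶠ θ in 𝓝[>] (0 : ℝ), θ < α :=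
    mem_nhdsWithin_of_mem_nhds (Iio_mem_nhds hα)
  filter_upwards [hs.eventually (gt_mem_nhds hneg), h1, self_mem_nhdsWithin] with θ hθ hθα hθ0
  have hθ0 : (0 : ℝ) < θ := hθ0
  refine ⟨hint θ (by rw [abs_of_pos hθ0]; exact hθα.le), ?_⟩
  rw [slope_def_field, sub_zero, ProbabilityTheory.mgf_zero, div_lt_iff₀ hθ0, zero_mul] at hθ
  have h2 : ProbabilityTheory.mgf X μ θ < 1 := by linarith
  exact h2

end ExpMoment

/-! ### Excursions between singular letters -/

/-- The words between two singular letters, together with the second of these letters. No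
restriction is put on the letters; `excursionMeasure` gives no mass to the wrong ones. -/
structure Excursion (k : ℕ) where
  /-- The number of letters between the two singular letters. -/
  gap : ℕ
  /-- The word between the two singular letters. -/
  word : Fin gap → Fin k
  /-- The second singular letter. -/
  last : Fin k

instance : MeasurableSpace (Excursion k) := ⊤

/-- The number of letters of an excursion. -/
noncomputable def Excursion.length (c : Excursion k) : ℝ := (c.gap : ℝ) + 1

/-- The image of a vector along an excursion. -/
noncomputable def Excursion.image (B : Fin k → Mat2) (u : Plane) (c : Excursion k) : Plane :=
  linMap (B c.last) (linMap (wordProd B c.gap c.word) u)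

/-- The law of the excursion. -/
noncomputable def excursionMeasure (p : PMF (Fin k)) (S : Finset (Fin k)) : Measure (Excursion k) :=
  Measure.sum fun n : ℕ => ∑ w : Fin n → Fin k, ∑ i : Fin k,
    ((∏ j, invWeight p S (w j)) * singWeight p S i) •
      Measure.dirac ⟨n, w, i⟩

theorem lintegral_excursionMeasure (p : PMF (Fin k)) (S : Finset (Fin k)) (F : Excursion k → ℝ≥0∞) :
    ∫⁻ c, F c ∂(excursionMeasure p S) = ∑' n : ℕ, ∑ w : Fin n → Fin k, ∑ i : Fin k,
      (∏ j, invWeight p S (w j)) * singWeight p S i * F ⟨n, w, i⟩ := by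
  rw [excursionMeasure, lintegral_sum_measure]
  refine tsum_congr fun n => ?_
  rw [lintegral_finsetSum_measure]
  refine Finset.sum_congr rfl fun w _ => ?_
  rw [lintegral_finsetSum_measure]
  refine Finset.sum_congr rfl fun i _ => ?_
  rw [lintegral_smul_measure, lintegral_dirac' _ measurable_from_top, smul_eq_mul]

/-- The probability of an invertible letter. -/
noncomputable def invMass (p : PMF (Fin k)) (S : Finset (Fin k)) : ℝ≥0∞ := ∑ i, invWeight p S i

theorem invMass_add (p : PMF (Fin k)) (S : Finset (Fin k)) :
    invMass p S + ∑ i, singWeight p S i = 1 := by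
  rw [invMass, ← Finset.sum_add_distrib]
  simp only [invWeight_add_singWeight]
  rw [← p.tsum_coe, tsum_fintype]

theorem invMass_lt_one {p : PMF (Fin k)} (hp : ∀ i, 0 < p i) {S : Finset (Fin k)}
    (hS : ∃ i, i ∈ S) : invMass p S < 1 := by
  obtain ⟨i, hi⟩ := hS
  have h1 : 0 < ∑ i, singWeight p S i := by
    refine lt_of_lt_of_le ?_ (Finset.single_le_sum (fun _ _ => zero_le) (Finset.mem_univ i))
    simpa [singWeight, hi] using hp i
  have h2 := invMass_add p S
  have h3 : invMass p S ≠ ∞ := ne_top_of_le_ne_top ENNReal.one_ne_top (h2 ▸ le_self_add)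
  calc invMass p S < invMass p S + ∑ i, singWeight p S i := ENNReal.lt_add_right h3 h1.ne'
    _ = 1 := h2

theorem lintegral_excursionMeasure_length (p : PMF (Fin k)) (S : Finset (Fin k)) (F : ℕ → ℝ≥0∞) :
    ∫⁻ c, F c.gap ∂(excursionMeasure p S) =
      ∑' n : ℕ, invMass p S ^ n * (∑ i, singWeight p S i) * F n := by
  rw [lintegral_excursionMeasure]
  refine tsum_congr fun n => ?_
  rw [invMass, Fintype.sum_pow, Finset.sum_mul_sum, Finset.sum_mul]
  exact Finset.sum_congr rfl fun _ _ => by rw [Finset.sum_mul]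

theorem isProbabilityMeasure_excursionMeasure {p : PMF (Fin k)} (hp : ∀ i, 0 < p i)
    {S : Finset (Fin k)} (hS : ∃ i, i ∈ S) : IsProbabilityMeasure (excursionMeasure p S) := by
  constructor
  have h := lintegral_excursionMeasure_length p S (fun _ => 1)
  simp only [lintegral_one, mul_one] at h
  rw [h, ENNReal.tsum_mul_right, ENNReal.tsum_geometric]
  have h2 := invMass_add p S
  have h3 : invMass p S ≠ ∞ := ne_top_of_le_ne_top ENNReal.one_ne_top (h2 ▸ le_self_add)
  have h4 : 1 - invMass p S = ∑ i, singWeight p S i := by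
    rw [← h2]; exact ENNReal.add_sub_cancel_left h3
  rw [← h4]
  exact ENNReal.inv_mul_cancel (tsub_pos_of_lt (invMass_lt_one hp hS)).ne'
    (ne_top_of_le_ne_top ENNReal.one_ne_top tsub_le_self)

theorem exists_rpow_mul_lt_one {r : ℝ≥0∞} (hr : r < 1) {D : ℝ} (hD : 1 ≤ D) :
    ∃ β : ℝ, 0 < β ∧ r * ENNReal.ofReal (D ^ β) < 1 := by
  have hD0 : 0 < D := by linarith
  have h1 : Tendsto (fun β : ℝ => r.toReal * D ^ β) (𝓝[>] 0) (𝓝 (r.toReal * 1)) := by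
    refine Tendsto.const_mul _ (tendsto_nhdsWithin_of_tendsto_nhds ?_)
    have := (Real.continuous_const_rpow hD0.ne').tendsto (0 : ℝ)
    simpa using this
  have h2 : r.toReal * 1 < 1 := by
    rw [mul_one]
    exact (ENNReal.toReal_lt_toReal hr.ne_top ENNReal.one_ne_top).2 hr
  obtain ⟨β, hβ, hβ0⟩ := ((h1.eventually (gt_mem_nhds h2)).and self_mem_nhdsWithin).exists
  refine ⟨β, hβ0, ?_⟩
  rw [← ENNReal.ofReal_toReal hr.ne_top, ← ENNReal.ofReal_mul ENNReal.toReal_nonneg]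
  exact ENNReal.ofReal_lt_one.2 hβ

theorem tsum_geometric_ne_top {x : ℝ≥0∞} (hx : x < 1) : ∑' n : ℕ, x ^ n ≠ ∞ := by
  rw [ENNReal.tsum_geometric]
  exact ENNReal.inv_ne_top.2 (tsub_pos_of_lt hx).ne'

theorem hasExpMoment_length {p : PMF (Fin k)} (hp : ∀ i, 0 < p i)
    {S : Finset (Fin k)} (hS : ∃ i, i ∈ S) :
    HasExpMoment Excursion.length (excursionMeasure p S) := by
  obtain ⟨β, hβ, hlt⟩ := exists_rpow_mul_lt_one (invMass_lt_one hp hS) (D := Real.exp 1)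
    (by simp)
  refine ⟨measurable_from_top, β, hβ, measurable_from_top.aestronglyMeasurable, ?_⟩
  rw [hasFiniteIntegral_iff_ofReal (Eventually.of_forall fun _ => (Real.exp_pos _).le)]
  have h1 : ∀ c : Excursion k, ENNReal.ofReal (Real.exp (β * |c.length|)) =
      (fun n : ℕ => ENNReal.ofReal (Real.exp 1 ^ β) ^ (n + 1)) c.gap := by
    intro c
    rw [← Real.exp_one_rpow (β * |c.length|), Real.rpow_mul (Real.exp_pos _).le]
    have : |c.length| = ((c.gap + 1 : ℕ) : ℝ) := by
      rw [Excursion.length, abs_of_nonneg (by positivity)]; push_cast; ring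
    rw [this, Real.rpow_natCast, ENNReal.ofReal_pow (by positivity)]
  simp only [h1]
  rw [lintegral_excursionMeasure_length p S (fun n => ENNReal.ofReal (Real.exp 1 ^ β) ^ (n + 1))]
  have h2 : ∀ n : ℕ, invMass p S ^ n * (∑ i, singWeight p S i) *
      ENNReal.ofReal (Real.exp 1 ^ β) ^ (n + 1) = ((∑ i, singWeight p S i) *
      ENNReal.ofReal (Real.exp 1 ^ β)) * (invMass p S * ENNReal.ofReal (Real.exp 1 ^ β)) ^ n := by
    intro n; rw [mul_pow]; ring
  simp only [h2]
  rw [ENNReal.tsum_mul_left]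
  refine (ENNReal.mul_ne_top (ENNReal.mul_ne_top ?_ ENNReal.ofReal_ne_top)
    (tsum_geometric_ne_top hlt)).lt_top
  exact ne_top_of_le_ne_top ENNReal.one_ne_top ((invMass_add p S) ▸ le_add_self)

/-! ### The drift function along excursions -/

theorem potential_apply (q : Fin k → ℝ≥0∞) (B : Fin k → Mat2) (c : ℝ≥0∞) (ψ : Plane → ℝ≥0∞)
    (u : Plane) :
    potential q B c ψ u = ∑' n : ℕ, ∑ w : Fin n → Fin k,
      c ^ n * (∏ j, q (w j)) * ψ (linMap (wordProd B n w) u) := by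
  simp only [potential, transfer_iterate_apply, Finset.mul_sum, mul_assoc]

theorem drift_eq (p : PMF (Fin k)) (S : Finset (Fin k)) (B : Fin k → Mat2) (c γ : ℝ≥0∞) (e : ℝ)
    (H : Fin k → ℝ≥0∞) (u : Plane) :
    drift p S B c γ e H u =
      ∫⁻ x : Excursion k, c ^ (x.gap + 1) * ‖x.image B u‖ₑ ^ e * H x.last ∂(excursionMeasure p S) +
        γ * potential (invWeight p S) B c (fun v => ‖v‖ₑ ^ e) u := by
  rw [drift, potential_apply, potential_apply, lintegral_excursionMeasure, ← ENNReal.tsum_mul_left,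
    ← ENNReal.tsum_add]
  refine tsum_congr fun n => ?_
  rw [Finset.mul_sum, ← Finset.sum_add_distrib]
  refine Finset.sum_congr rfl fun w _ => ?_
  rw [exitCost, mul_add]
  congr 1
  · rw [Finset.mul_sum, Finset.mul_sum]
    refine Finset.sum_congr rfl fun i _ => ?_
    simp only [Excursion.image]
    ring
  · ring

theorem norm_wordProd_le {S : Finset (Fin k)} {B : Fin k → Mat2} {D : ℝ} (hD : 0 ≤ D)
    (h1 : ∀ j ∉ S, ∀ u, ‖linMap (B j) u‖ ≤ D * ‖u‖) {n : ℕ} {w : Fin n → Fin k}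
    (hw : ∀ j, w j ∉ S) (u : Plane) : ‖linMap (wordProd B n w) u‖ ≤ D ^ n * ‖u‖ := by
  induction n with
  | zero => simp [wordProd, linMap_one]
  | succ n ih =>
    rw [wordProd, linMap_mul, pow_succ', mul_assoc]
    exact (h1 _ (hw _) _).trans (mul_le_mul_of_nonneg_left (ih fun j => hw _) hD)

theorem le_norm_wordProd {S : Finset (Fin k)} {B : Fin k → Mat2} {D : ℝ} (hD : 0 ≤ D)
    (h1 : ∀ j ∉ S, ∀ u, ‖u‖ ≤ D * ‖linMap (B j) u‖) {n : ℕ} {w : Fin n → Fin k}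
    (hw : ∀ j, w j ∉ S) (u : Plane) : ‖u‖ ≤ D ^ n * ‖linMap (wordProd B n w) u‖ := by
  induction n with
  | zero => simp [wordProd, linMap_one]
  | succ n ih =>
    rw [wordProd, linMap_mul, pow_succ, mul_assoc]
    exact (ih (w := Fin.init w) fun j => hw _).trans
      (mul_le_mul_of_nonneg_left (h1 _ (hw _) _) (by positivity))

theorem enorm_wordProd_rpow_le {S : Finset (Fin k)} {B : Fin k → Mat2} {D : ℝ} (hD : 1 ≤ D)
    (h1 : ∀ j ∉ S, ∀ u, ‖linMap (B j) u‖ ≤ D * ‖u‖)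
    (h2 : ∀ j ∉ S, ∀ u, ‖u‖ ≤ D * ‖linMap (B j) u‖) {n : ℕ} {w : Fin n → Fin k}
    (hw : ∀ j, w j ∉ S) (e : ℝ) (u : Plane) :
    ‖linMap (wordProd B n w) u‖ₑ ^ e ≤ ENNReal.ofReal (D ^ |e|) ^ n * ‖u‖ₑ ^ e := by
  have hD0 : 0 < D := by linarith
  have hDn : ENNReal.ofReal (D ^ |e|) ^ n = ENNReal.ofReal (D ^ n) ^ |e| := by
    rw [← ENNReal.ofReal_pow (by positivity), ENNReal.ofReal_rpow_of_pos (by positivity),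
      ← Real.rpow_natCast, ← Real.rpow_mul hD0.le, mul_comm, Real.rpow_mul hD0.le,
      Real.rpow_natCast]
  have hu : ‖linMap (wordProd B n w) u‖ₑ ≤ ENNReal.ofReal (D ^ n) * ‖u‖ₑ := by
    rw [← ofReal_norm, ← ofReal_norm, ← ENNReal.ofReal_mul (by positivity)]
    exact ENNReal.ofReal_le_ofReal (norm_wordProd_le hD0.le h1 hw u)
  have hl : ‖u‖ₑ ≤ ENNReal.ofReal (D ^ n) * ‖linMap (wordProd B n w) u‖ₑ := by
    rw [← ofReal_norm, ← ofReal_norm, ← ENNReal.ofReal_mul (by positivity)]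
    exact ENNReal.ofReal_le_ofReal (le_norm_wordProd hD0.le h2 hw u)
  rw [hDn]
  have hDne : ENNReal.ofReal (D ^ n) ≠ 0 := (ENNReal.ofReal_pos.2 (by positivity)).ne'
  rcases le_total 0 e with he | he
  · rw [abs_of_nonneg he, ← ENNReal.mul_rpow_of_nonneg _ _ he]
    exact ENNReal.rpow_le_rpow hu he
  · rw [abs_of_nonpos he]
    have h3 := ENNReal.inv_le_inv.2 (ENNReal.rpow_le_rpow hl (neg_nonneg.2 he))
    rw [← ENNReal.rpow_neg, ← ENNReal.rpow_neg, neg_neg] at h3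
    rw [ENNReal.mul_rpow_of_ne_top ENNReal.ofReal_ne_top enorm_ne_top] at h3
    calc ‖linMap (wordProd B n w) u‖ₑ ^ e = ENNReal.ofReal (D ^ n) ^ (-e) *
          (ENNReal.ofReal (D ^ n) ^ e * ‖linMap (wordProd B n w) u‖ₑ ^ e) := by
          rw [← mul_assoc, ← ENNReal.rpow_add _ _ hDne ENNReal.ofReal_ne_top, neg_add_cancel,
            ENNReal.rpow_zero, one_mul]
      _ ≤ _ := mul_le_mul_right h3 _

/-! ### Construction of the drift function -/

theorem potential_enorm_rpow_le {p : PMF (Fin k)} {S : Finset (Fin k)} {B : Fin k → Mat2} {D : ℝ}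
    (hD : 1 ≤ D) (h1 : ∀ j ∉ S, ∀ u, ‖linMap (B j) u‖ ≤ D * ‖u‖)
    (h2 : ∀ j ∉ S, ∀ u, ‖u‖ ≤ D * ‖linMap (B j) u‖) (c : ℝ≥0∞) (e : ℝ) (u : Plane) :
    potential (invWeight p S) B c (fun v => ‖v‖ₑ ^ e) u ≤
      (∑' n : ℕ, (invMass p S * (c * ENNReal.ofReal (D ^ |e|))) ^ n) * ‖u‖ₑ ^ e := by
  rw [potential_apply, ← ENNReal.tsum_mul_right]
  refine ENNReal.tsum_le_tsum fun n => ?_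
  rw [mul_pow, invMass, Fintype.sum_pow, Finset.sum_mul, Finset.sum_mul]
  refine Finset.sum_le_sum fun w _ => ?_
  by_cases hw : ∀ j, w j ∉ S
  · calc c ^ n * (∏ j, invWeight p S (w j)) * ‖linMap (wordProd B n w) u‖ₑ ^ e
        ≤ c ^ n * (∏ j, invWeight p S (w j)) * (ENNReal.ofReal (D ^ |e|) ^ n * ‖u‖ₑ ^ e) :=
          mul_le_mul_right (enorm_wordProd_rpow_le hD h1 h2 hw e u) _
      _ = _ := by rw [mul_pow]; ring
  · push Not at hw
    obtain ⟨j, hj⟩ := hw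
    have : ∏ j, invWeight p S (w j) = 0 :=
      Finset.prod_eq_zero (Finset.mem_univ j) (by simp [invWeight, hj])
    simp [this]

theorem potential_mono {q : Fin k → ℝ≥0∞} {B : Fin k → Mat2} {c : ℝ≥0∞} {f g : Plane → ℝ≥0∞}
    (h : ∀ u, f u ≤ g u) (u : Plane) : potential q B c f u ≤ potential q B c g u := by
  rw [potential_apply, potential_apply]
  exact ENNReal.tsum_le_tsum fun n => Finset.sum_le_sum fun w _ => mul_le_mul_right (h _) _

theorem potential_const_mul (q : Fin k → ℝ≥0∞) (B : Fin k → Mat2) (c a : ℝ≥0∞)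
    (f : Plane → ℝ≥0∞) (u : Plane) :
    potential q B c (fun v => a * f v) u = a * potential q B c f u := by
  rw [potential_apply, potential_apply, ← ENNReal.tsum_mul_left]
  refine tsum_congr fun n => ?_
  rw [Finset.mul_sum]
  exact Finset.sum_congr rfl fun _ _ => by ring

section FixedCocycle

variable {p : PMF (Fin k)} {S : Finset (Fin k)} {B : Fin k → Mat2} {D : ℝ} {r : Fin k → Plane}

theorem norm_image_le (hD : 1 ≤ D) (hup : ∀ i u, ‖linMap (B i) u‖ ≤ D * ‖u‖) (u : Plane)
    (c : Excursion k) : ‖c.image B u‖ ≤ D ^ (c.gap + 1) * ‖u‖ := by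
  have hD0 : 0 ≤ D := by linarith
  rw [Excursion.image, pow_succ', mul_assoc]
  refine (hup _ _).trans (mul_le_mul_of_nonneg_left ?_ hD0)
  exact norm_wordProd_le (S := ∅) hD0 (fun j _ => hup j) (by simp) u

theorem hasExpMoment_log_image (hp : ∀ i, 0 < p i) (hS : ∃ i, i ∈ S) (hD : 1 ≤ D)
    (hup : ∀ i u, ‖linMap (B i) u‖ ≤ D * ‖u‖) {u : Plane} (hu : ‖u‖ = 1) {α : ℝ} (hα : 0 < α)
    (hH : ∫⁻ c, ‖c.image B u‖ₑ ^ (-α) ∂(excursionMeasure p S) ≠ ∞) :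
    HasExpMoment (fun c : Excursion k => Real.log ‖c.image B u‖) (excursionMeasure p S) := by
  have hlD : 0 ≤ Real.log D := Real.log_nonneg hD
  obtain ⟨-, β, hβ, hint⟩ := hasExpMoment_length (p := p) hp hS
  have hint2 : Integrable (fun c : Excursion k => (‖c.image B u‖ₑ ^ (-α)).toReal)
      (excursionMeasure p S) :=
    integrable_toReal_of_lintegral_ne_top measurable_from_top.aemeasurable hH
  have hδ : 0 < min α (β / (Real.log D + 1)) := lt_min hα (by positivity)
  have hδα := min_le_left α (β / (Real.log D + 1))
  have hδβ := min_le_right α (β / (Real.log D + 1))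
  set δ := min α (β / (Real.log D + 1))
  refine ⟨measurable_from_top, δ, hδ, ?_⟩
  refine (hint.add hint2).mono' measurable_from_top.aestronglyMeasurable
    (Eventually.of_forall fun c => ?_)
  rw [Real.norm_eq_abs, abs_of_pos (Real.exp_pos _), Pi.add_apply]
  beta_reduce
  have hy := norm_image_le hD hup u c
  rw [hu, mul_one] at hy
  rw [← ENNReal.toReal_rpow, toReal_enorm]
  have hlen : |c.length| = (c.gap : ℝ) + 1 := by
    rw [Excursion.length, abs_of_nonneg (by positivity)]
  have hN : 0 ≤ (c.gap : ℝ) + 1 := by positivity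
  rw [hlen]
  have hy0 : 0 ≤ ‖c.image B u‖ := norm_nonneg _
  generalize ‖c.image B u‖ = y at *
  rcases hy0.eq_or_lt with rfl | hy0
  -- On a null set the image vanishes, where `Real.log` takes the value `0`.
  · rw [Real.log_zero, abs_zero, mul_zero]
    exact (Real.exp_le_exp.2 (by positivity)).trans (le_add_of_nonneg_right (by positivity))
  rcases le_total 1 y with h1 | h1
  · refine le_trans (Real.exp_le_exp.2 ?_) (le_add_of_nonneg_right (by positivity))
    rw [abs_of_nonneg (Real.log_nonneg h1)]
    have h2 : Real.log y ≤ ((c.gap : ℝ) + 1) * Real.log D := by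
      have := Real.log_le_log hy0 hy
      rw [Real.log_pow] at this
      exact_mod_cast this
    calc δ * Real.log y ≤ (β / (Real.log D + 1)) * (((c.gap : ℝ) + 1) * Real.log D) := by
          gcongr
          exact Real.log_nonneg h1
      _ = (β * ((c.gap : ℝ) + 1)) * (Real.log D / (Real.log D + 1)) := by ring
      _ ≤ (β * ((c.gap : ℝ) + 1)) * 1 := by
          gcongr
          rw [div_le_one (by positivity)]; linarith
      _ = _ := mul_one _
  · refine le_trans ?_ (le_add_of_nonneg_left (Real.exp_pos _).le)
    rw [Real.rpow_def_of_pos hy0, Real.exp_le_exp, abs_of_nonpos (Real.log_nonpos hy0.le h1)]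
    nlinarith [Real.log_nonpos hy0.le h1]

/-- The Lyapunov exponent is the expected logarithmic growth over an excursion divided by the
expected length of the excursion; the letters at the beginning and at the end of an excursion
are independent. At this value of `L` the drift function exists in both directions `σ = ± 1`, for
every error `ε`. -/
theorem exists_drift (hp : ∀ i, 0 < p i) (hS : ∃ i, i ∈ S) (hD : 1 ≤ D)
    (hup : ∀ i u, ‖linMap (B i) u‖ ≤ D * ‖u‖)
    (hlow : ∀ j ∉ S, ∀ u, ‖u‖ ≤ D * ‖linMap (B j) u‖)
    (hr : ∀ i ∈ S, ‖r i‖ = 1) (hB : ∀ i ∈ S, ∀ u, ∃ a : ℝ, linMap (B i) u = a • r i)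
    {α : ℝ} (hα : 0 < α)
    (hH : ∀ i ∈ S, ∫⁻ c, ‖c.image B (r i)‖ₑ ^ (-α) ∂(excursionMeasure p S) ≠ ∞) :
    ∃ L : ℝ, ∀ σ : ℝ, σ = 1 ∨ σ = -1 → ∀ ε > 0, ∃ θ > 0, ∃ γ : ℝ, 0 < γ ∧ ∃ h : Plane → ℝ≥0∞,
      (∀ u, ENNReal.ofReal (Real.exp (-(θ * (σ * L + ε)))) * transfer p B h u ≤ h u) ∧
      (∀ u, ENNReal.ofReal γ * ‖u‖ₑ ^ (θ * σ) ≤ h u) ∧ (∀ i ∈ S, h (r i) ≠ ∞) ∧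
      (σ = 1 → ∀ u, h u ≠ ∞) := by
  set ν := excursionMeasure p S with hν
  have : IsProbabilityMeasure ν := isProbabilityMeasure_excursionMeasure hp hS
  have hX : ∀ i ∈ S, HasExpMoment (fun c : Excursion k => Real.log ‖c.image B (r i)‖) ν :=
    fun i hi => hasExpMoment_log_image hp hS hD hup (hr i hi) hα (hH i hi)
  have hN : HasExpMoment Excursion.length ν := hasExpMoment_length hp hS
  set m : Fin k → ℝ := fun i => ∫ c, Real.log ‖c.image B (r i)‖ ∂ν with hm
  have hG : HasExpMoment (fun c : Excursion k => m c.last) ν := by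
    refine hasExpMoment_of_bounded measurable_from_top (C := ∑ i, |m i|) fun c => ?_
    exact Finset.single_le_sum (f := fun i => |m i|) (fun _ _ => abs_nonneg _)
      (Finset.mem_univ c.last)
  set T : ℝ := ∫ c, Excursion.length c ∂ν with hT
  have hTpos : 0 < T := by
    have h1 : ∫ _, (1 : ℝ) ∂ν ≤ T := by
      refine integral_mono (integrable_const _) hN.integrable fun c => ?_
      simp [Excursion.length]
    simp at h1
    linarith
  set L : ℝ := (∫ c : Excursion k, m c.last ∂ν) / T with hL
  refine ⟨L, fun σ hσ ε hε => ?_⟩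
  have hσ0 : σ ≠ 0 := by rcases hσ with rfl | rfl <;> norm_num
  -- The centred growth over an excursion, corrected by a coboundary that makes its mean
  -- independent of the initial letter.
  set W : Fin k → Excursion k → ℝ := fun i c =>
    σ * Real.log ‖c.image B (r i)‖ + (-(σ * L + ε)) * c.length + σ * m c.last + -(σ * m i) with hW
  have hWexp : ∀ i ∈ S, HasExpMoment (W i) ν := fun i hi =>
    ((((hX i hi).const_mul σ).add (hN.const_mul _)).add (hG.const_mul σ)).add
      (hasExpMoment_of_bounded measurable_const fun _ => le_rfl)
  have hWneg : ∀ i ∈ S, ∫ c, W i c ∂ν < 0 := by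
    intro i hi
    have e1 := (hX i hi).integrable.const_mul σ
    have e2 := hN.integrable.const_mul (-(σ * L + ε))
    have e3 := hG.integrable.const_mul σ
    have e12 : Integrable (fun c : Excursion k => σ * Real.log ‖c.image B (r i)‖ +
        -(σ * L + ε) * c.length) ν := e1.add e2
    have e123 : Integrable (fun c : Excursion k => σ * Real.log ‖c.image B (r i)‖ +
        -(σ * L + ε) * c.length + σ * m c.last) ν := e12.add e3
    simp only [hW]
    rw [integral_add e123 (integrable_const _), integral_add e12 e3, integral_add e1 e2,
      integral_const_mul, integral_const_mul, integral_const_mul, integral_const]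
    have h1 : ∫ c : Excursion k, m c.last ∂ν = L * T := by rw [hL]; field_simp
    have h2 : ∫ c, Real.log ‖c.image B (r i)‖ ∂ν = m i := rfl
    rw [h1, ← hT, h2]
    simp only [probReal_univ, smul_eq_mul, one_mul]
    nlinarith
  have hev : ∀ᶠ θ in 𝓝[>] (0 : ℝ), ∀ i ∈ S, Integrable (fun ω => Real.exp (θ * W i ω)) ν ∧
      ∫ ω, Real.exp (θ * W i ω) ∂ν < 1 :=
    (Filter.eventually_all_finset S).2 fun i hi => (hWexp i hi).mgf_lt_one (hWneg i hi)
  have hgeo : ∀ᶠ θ in 𝓝[>] (0 : ℝ), invMass p S * (ENNReal.ofReal (Real.exp (-(θ * (σ * L + ε))))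
      * ENNReal.ofReal (D ^ |θ * σ|)) < 1 := by
    have hc : Continuous fun θ : ℝ =>
        (invMass p S).toReal * (Real.exp (-(θ * (σ * L + ε))) * D ^ |θ * σ|) := by
      have : Continuous fun θ : ℝ => D ^ |θ * σ| :=
        (Real.continuous_const_rpow (by positivity)).comp (by fun_prop)
      fun_prop
    have h0 := hc.tendsto 0
    have hr1 := invMass_lt_one hp hS
    have h1 : (invMass p S).toReal < 1 :=
      (ENNReal.toReal_lt_toReal hr1.ne_top ENNReal.one_ne_top).2 hr1
    simp only [zero_mul, neg_zero, Real.exp_zero, abs_zero, Real.rpow_zero, mul_one] at h0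
    refine mem_nhdsWithin_of_mem_nhds ?_
    filter_upwards [h0.eventually (gt_mem_nhds h1)] with θ hθ
    rw [← ENNReal.ofReal_toReal hr1.ne_top, ← ENNReal.ofReal_mul (Real.exp_pos _).le,
      ← ENNReal.ofReal_mul ENNReal.toReal_nonneg]
    exact ENNReal.ofReal_lt_one.2 hθ
  obtain ⟨θ, ⟨hmgf, hgeoθ⟩, hθ0⟩ := ((hev.and hgeo).and self_mem_nhdsWithin).exists
  have hθ0 : 0 < θ := hθ0
  set c : ℝ≥0∞ := ENNReal.ofReal (Real.exp (-(θ * (σ * L + ε)))) with hc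
  set H : Fin k → ℝ≥0∞ := fun i => ENNReal.ofReal (Real.exp (θ * (σ * m i))) with hHdef
  set b : Plane → ℝ≥0∞ := potential (invWeight p S) B c (fun v => ‖v‖ₑ ^ (θ * σ)) with hb
  have hble : ∀ u, b u ≤ _ := potential_enorm_rpow_le hD (fun j _ => hup j) hlow c (θ * σ)
  have hbr : ∀ i ∈ S, b (r i) ≠ ∞ := by
    intro i hi
    refine ne_top_of_le_ne_top (ENNReal.mul_ne_top (tsum_geometric_ne_top hgeoθ) ?_) (hble _)
    rw [← ofReal_norm, hr i hi, ENNReal.ofReal_one, ENNReal.one_rpow]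
    exact ENNReal.one_ne_top
  have hmain : ∀ i ∈ S, ∫⁻ x : Excursion k,
      c ^ (x.gap + 1) * ‖x.image B (r i)‖ₑ ^ (θ * σ) * H x.last ∂ν ≤
        ENNReal.ofReal (Real.exp (θ * (σ * m i)) * ∫ x, Real.exp (θ * W i x) ∂ν) := by
    intro i hi
    rw [← integral_const_mul, ofReal_integral_eq_lintegral_ofReal ((hmgf i hi).1.const_mul _)
      (Eventually.of_forall fun _ => by positivity)]
    refine lintegral_mono_ae ?_
    have hne : ∀ᵐ x ∂ν, ‖x.image B (r i)‖ₑ ^ (-α) < ∞ :=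
      ae_lt_top' measurable_from_top.aemeasurable (hH i hi)
    filter_upwards [hne] with x hx
    have hpos : 0 < ‖x.image B (r i)‖ := by
      by_contra h0
      have h1 : x.image B (r i) = 0 := by simpa using h0
      rw [h1, enorm_zero, ENNReal.zero_rpow_of_neg (by linarith)] at hx
      exact lt_irrefl _ hx
    rw [← ofReal_norm, ENNReal.ofReal_rpow_of_pos hpos, hc, hHdef,
      ← ENNReal.ofReal_pow (Real.exp_pos _).le, ← ENNReal.ofReal_mul (by positivity),
      ← ENNReal.ofReal_mul (by positivity), Real.rpow_def_of_pos hpos, ← Real.exp_nat_mul,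
      ← Real.exp_add, ← Real.exp_add, ← Real.exp_add]
    refine le_of_eq (congrArg _ (congrArg _ ?_))
    simp only [hW, Excursion.length]
    push_cast
    ring
  -- A weight `γ` small enough that stopping costs less than the gain over an excursion.
  obtain ⟨γ, hγ, hγ0⟩ : ∃ γ : ℝ, (∀ i ∈ S, γ * (b (r i)).toReal <
      Real.exp (θ * (σ * m i)) * (1 - ∫ x, Real.exp (θ * W i x) ∂ν)) ∧ 0 < γ := by
    have h1 : ∀ i ∈ S, ∀ᶠ γ in 𝓝[>] (0 : ℝ), γ * (b (r i)).toReal <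
        Real.exp (θ * (σ * m i)) * (1 - ∫ x, Real.exp (θ * W i x) ∂ν) := by
      intro i hi
      have h2 : Tendsto (fun γ : ℝ => γ * (b (r i)).toReal) (𝓝[>] 0) (𝓝 (0 * (b (r i)).toReal)) :=
        tendsto_nhdsWithin_of_tendsto_nhds ((continuous_mul_const _).tendsto 0)
      rw [zero_mul] at h2
      exact h2.eventually (gt_mem_nhds (mul_pos (Real.exp_pos _) (by linarith [(hmgf i hi).2])))
    exact (((Filter.eventually_all_finset S).2 h1).and self_mem_nhdsWithin).exists
  have hγne : ENNReal.ofReal γ ≠ 0 := (ENNReal.ofReal_pos.2 hγ0).ne'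
  have hdrift : ∀ i ∈ S, drift p S B c (ENNReal.ofReal γ) (θ * σ) H (r i) ≤ H i := by
    intro i hi
    rw [drift_eq]
    refine (add_le_add (hmain i hi) (le_of_eq rfl)).trans ?_
    rw [← hb, ← ENNReal.ofReal_toReal (hbr i hi), ← ENNReal.ofReal_mul hγ0.le,
      ← ENNReal.ofReal_add (mul_nonneg (Real.exp_pos _).le
        (integral_nonneg fun _ => (Real.exp_pos _).le)) (by positivity)]
    refine ENNReal.ofReal_le_ofReal ?_
    have := hγ i hi
    linarith
  refine ⟨θ, hθ0, γ, hγ0, drift p S B c (ENNReal.ofReal γ) (θ * σ) H,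
    transfer_drift_le (mul_ne_zero hθ0.ne' hσ0) hγne hr hB hdrift, le_drift, fun i hi => ?_, ?_⟩
  · exact ne_top_of_le_ne_top ENNReal.ofReal_ne_top (hdrift i hi)
  · intro hσ1 u
    have hθσ : 0 < θ * σ := by rw [hσ1, mul_one]; exact hθ0
    set K : ℝ≥0∞ := c * ∑ i, singWeight p S i * (ENNReal.ofReal D ^ (θ * σ) * H i) +
      ENNReal.ofReal γ with hK
    have hKtop : K ≠ ∞ := by
      refine ENNReal.add_ne_top.2 ⟨ENNReal.mul_ne_top ENNReal.ofReal_ne_top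
        (ENNReal.sum_ne_top.2 fun i _ => ?_), ENNReal.ofReal_ne_top⟩
      refine ENNReal.mul_ne_top ?_ (ENNReal.mul_ne_top
        (ENNReal.rpow_ne_top_of_nonneg hθσ.le ENNReal.ofReal_ne_top) ENNReal.ofReal_ne_top)
      rw [singWeight]
      split_ifs
      · exact p.apply_ne_top i
      · exact ENNReal.zero_ne_top
    have hexit : ∀ v, exitCost p S B c (ENNReal.ofReal γ) (θ * σ) H v ≤ K * ‖v‖ₑ ^ (θ * σ) := by
      intro v
      rw [exitCost, hK, add_mul, mul_assoc, Finset.sum_mul]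
      refine add_le_add (mul_le_mul_right (Finset.sum_le_sum fun i _ => ?_) _) le_rfl
      rw [mul_assoc (singWeight p S i)]
      refine mul_le_mul_right ?_ _
      rw [mul_right_comm, ← ENNReal.mul_rpow_of_nonneg _ _ hθσ.le]
      gcongr
      rw [← ofReal_norm, ← ofReal_norm, ← ENNReal.ofReal_mul (by positivity)]
      exact ENNReal.ofReal_le_ofReal (hup i v)
    refine ne_top_of_le_ne_top ?_ ((potential_mono hexit u).trans
      (le_of_eq (potential_const_mul _ _ _ _ _ _)))
    refine ENNReal.mul_ne_top hKtop (ne_top_of_le_ne_top (ENNReal.mul_ne_top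
      (tsum_geometric_ne_top hgeoθ) ?_) (hble u))
    exact ENNReal.rpow_ne_top_of_nonneg hθσ.le enorm_ne_top

end FixedCocycle

/-! ### Exponential decay and the Lyapunov exponent -/

/-- Exponential decay of a sequence, from the index `1` on. -/
def DecaysExp (f : ℕ → ℝ≥0∞) : Prop :=
  ∃ C c : ℝ, 0 < c ∧ ∀ n : ℕ, 0 < n → f n ≤ ENNReal.ofReal (C * Real.exp (-(c * n)))

theorem DecaysExp.mono {f g : ℕ → ℝ≥0∞} (hg : DecaysExp g) (h : ∀ n, 0 < n → f n ≤ g n) :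
    DecaysExp f := by
  obtain ⟨C, c, hc, hgn⟩ := hg
  exact ⟨C, c, hc, fun n hn => (h n hn).trans (hgn n hn)⟩

theorem DecaysExp.add {f g : ℕ → ℝ≥0∞} (hf : DecaysExp f) (hg : DecaysExp g) :
    DecaysExp fun n => f n + g n := by
  obtain ⟨C, c, hc, hfn⟩ := hf
  obtain ⟨C', c', hc', hgn⟩ := hg
  refine ⟨|C| + |C'|, min c c', lt_min hc hc', fun n hn => ?_⟩
  refine (add_le_add (hfn n hn) (hgn n hn)).trans ?_
  rw [add_mul, ENNReal.ofReal_add (by positivity) (by positivity)]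
  refine add_le_add (ENNReal.ofReal_le_ofReal ?_) (ENNReal.ofReal_le_ofReal ?_)
  · gcongr
    · exact le_abs_self C
    · exact min_le_left _ _
  · gcongr
    · exact le_abs_self C'
    · exact min_le_right _ _

theorem DecaysExp.exists_lt {f : ℕ → ℝ≥0∞} (hf : DecaysExp f) :
    ∃ n₀ : ℕ, ∀ n ≥ n₀, f n < ENNReal.ofReal (Real.exp (-(1 * (n : ℝ) ^ (1 / 3 : ℝ)))) := by
  obtain ⟨C, c, hc, hfn⟩ := hf
  have h1 : Tendsto (fun n : ℕ => (n : ℝ) ^ (-(2 / 3) : ℝ)) atTop (𝓝 0) :=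
    (tendsto_rpow_neg_atTop (by norm_num)).comp tendsto_natCast_atTop_atTop
  have h2 : Tendsto (fun n : ℕ => C * Real.exp (-(c / 2 * (n : ℝ)))) atTop (𝓝 (C * 0)) := by
    refine Tendsto.const_mul _ (Real.tendsto_exp_neg_atTop_nhds_zero.comp ?_)
    exact tendsto_natCast_atTop_atTop.const_mul_atTop (by positivity)
  rw [mul_zero] at h2
  rw [← eventually_atTop]
  filter_upwards [h1.eventually (gt_mem_nhds (half_pos hc)), h2.eventually (gt_mem_nhds one_pos),
    eventually_gt_atTop 0] with n hn1 hn2 hn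
  refine (hfn n hn).trans_lt ((ENNReal.ofReal_lt_ofReal_iff (Real.exp_pos _)).2 ?_)
  have hn' : (0 : ℝ) < n := by exact_mod_cast hn
  have h3 : (n : ℝ) ^ (1 / 3 : ℝ) ≤ c / 2 * n := by
    have : (n : ℝ) ^ (1 / 3 : ℝ) = (n : ℝ) ^ (-(2 / 3) : ℝ) * n := by
      conv_rhs => rw [← Real.rpow_add_one hn'.ne']
      norm_num
    rw [this]
    gcongr
  calc C * Real.exp (-(c * n)) = C * Real.exp (-(c / 2 * n)) * Real.exp (-(c / 2 * n)) := by
        rw [mul_assoc, ← Real.exp_add]; ring_nf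
    _ < 1 * Real.exp (-(c / 2 * n)) := mul_lt_mul_of_pos_right hn2 (Real.exp_pos _)
    _ ≤ _ := by rw [one_mul, one_mul]; exact Real.exp_le_exp.2 (neg_le_neg h3)

theorem DecaysExp.tsum_ne_top {f : ℕ → ℝ≥0∞} (hf : DecaysExp f) : ∑' n, f (n + 1) ≠ ∞ := by
  obtain ⟨C, c, hc, hfn⟩ := hf
  have h1 : Summable fun n : ℕ => C * Real.exp (-(c * ((n + 1 : ℕ) : ℝ))) := by
    refine Summable.mul_left C ?_
    have h2 : Summable fun n : ℕ => Real.exp (-c) ^ n :=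
      summable_geometric_of_lt_one (Real.exp_pos _).le (by simpa using hc)
    refine ((summable_nat_add_iff 1).2 h2).congr fun n => ?_
    rw [← Real.exp_nat_mul]; congr 1; ring
  exact ne_top_of_le_ne_top h1.tsum_ofReal_ne_top
    (ENNReal.tsum_le_tsum fun n => hfn (n + 1) n.succ_pos)

theorem abs_log_div_sub_le {y : ℝ≥0∞} {n : ℕ} (hn : 0 < n) {L ε : ℝ}
    (h1 : ENNReal.ofReal (Real.exp (n * (L - ε))) ≤ y)
    (h2 : y ≤ ENNReal.ofReal (Real.exp (n * (L + ε)))) :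
    (ENNReal.log y / (n : EReal) - (L : EReal)).abs ≤ ENNReal.ofReal ε := by
  have hn' : (0 : ℝ) < n := by exact_mod_cast hn
  have hy : y ≠ ∞ := ne_top_of_le_ne_top ENNReal.ofReal_ne_top h2
  rw [← ENNReal.ofReal_toReal hy] at h1 h2 ⊢
  have hy0 : 0 < y.toReal :=
    ENNReal.ofReal_pos.1 (lt_of_lt_of_le (ENNReal.ofReal_pos.2 (Real.exp_pos _)) h1)
  have h1' := (ENNReal.ofReal_le_ofReal_iff hy0.le).1 h1
  have h2' := (ENNReal.ofReal_le_ofReal_iff (Real.exp_pos _).le).1 h2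
  rw [← Real.le_log_iff_exp_le hy0] at h1'
  rw [← Real.log_le_iff_le_exp hy0] at h2'
  rw [ENNReal.log_ofReal_of_pos hy0]
  have : ((Real.log y.toReal : ℝ) : EReal) / (n : EReal) - (L : EReal) =
      ((Real.log y.toReal / n - L : ℝ) : EReal) := by
    rw [EReal.coe_sub, EReal.coe_div]; rfl
  rw [this, EReal.abs_def]
  refine ENNReal.ofReal_le_ofReal (abs_le.2 ⟨?_, ?_⟩)
  · have : L - ε ≤ Real.log y.toReal / n := by rw [le_div_iff₀ hn']; linarith
    linarith
  · have : Real.log y.toReal / n ≤ L + ε := by rw [div_le_iff₀ hn']; linarith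
    linarith

theorem tendsto_of_abs_sub_le {x : ℕ → EReal} {L : ℝ}
    (h : ∀ m : ℕ, ∀ᶠ n in atTop, (x n - (L : EReal)).abs ≤ ENNReal.ofReal (1 / ((m : ℝ) + 1))) :
    Tendsto x atTop (𝓝 (L : EReal)) := by
  have hreal : ∀ (y : EReal) (ε : ℝ), (y - (L : EReal)).abs ≤ ENNReal.ofReal ε →
      ∃ z : ℝ, y = z ∧ |z - L| ≤ max ε 0 := by
    intro y ε hy
    induction y with
    | bot => simp at hy
    | top => simp at hy
    | coe z =>
      refine ⟨z, rfl, ?_⟩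
      rw [← EReal.coe_sub, EReal.abs_def] at hy
      rcases le_total 0 ε with h0 | h0
      · exact ((ENNReal.ofReal_le_ofReal_iff h0).1 hy).trans (le_max_left _ _)
      · rw [ENNReal.ofReal_of_nonpos h0] at hy
        have := ENNReal.ofReal_eq_zero.1 (le_antisymm hy zero_le)
        exact this.trans (le_max_right _ _)
  have h1 : ∀ᶠ n in atTop, ((x n).toReal : EReal) = x n := by
    filter_upwards [h 0] with n hn
    obtain ⟨z, hz, -⟩ := hreal _ _ hn
    rw [hz, EReal.toReal_coe]
  have h2 : Tendsto (fun n => (x n).toReal) atTop (𝓝 L) := by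
    rw [Metric.tendsto_nhds]
    intro ε hε
    obtain ⟨m, hm⟩ := exists_nat_one_div_lt hε
    filter_upwards [h m] with n hn
    obtain ⟨z, hz, hzL⟩ := hreal _ _ hn
    rw [hz, EReal.toReal_coe, Real.dist_eq]
    rw [max_eq_left (by positivity)] at hzL
    linarith
  exact (((continuous_coe_real_ereal.tendsto L).comp h2)).congr' h1

/-- Exponential concentration identifies the Lyapunov exponent, by the Borel–Cantelli lemma. -/
theorem topLyapunov_eq_of_decaysExp {p : PMF (Fin k)} {B : Fin k → Mat2} {L : ℝ}
    (h : ∀ ε > 0, DecaysExp fun n => bernoulliMeasure p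
      {ω | ENNReal.ofReal ε < (normGrowth B n ω - (L : EReal)).abs}) :
    topLyapunov p B = L := by
  refine topLyapunov_eq ?_
  have h1 : ∀ᵐ ω ∂(bernoulliMeasure p), ∀ m : ℕ, ∀ᶠ n in atTop,
      ω ∉ {ω | ENNReal.ofReal (1 / ((m : ℝ) + 1)) <
        (normGrowth B (n + 1) ω - (L : EReal)).abs} :=
    ae_all_iff.2 fun m => ae_eventually_notMem (h _ (by positivity)).tsum_ne_top
  filter_upwards [h1] with ω hω
  rw [← tendsto_add_atTop_iff_nat 1]
  refine tendsto_of_abs_sub_le fun m => ?_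
  filter_upwards [hω m] with n hn
  exact not_lt.1 hn

/-! ### Large deviations for a fixed cocycle -/

section FixedCocycle

variable {p : PMF (Fin k)} {S : Finset (Fin k)} {B : Fin k → Mat2} {D : ℝ} {r : Fin k → Plane}

/-- Chernoff's bound from a superharmonic function. -/
theorem decaysExp_of_superharmonic {θ σ L ε γ : ℝ} (hθ : 0 < θ) (hε : 0 < ε) (hγ : 0 < γ)
    {h : Plane → ℝ≥0∞}
    (hsup : ∀ u, ENNReal.ofReal (Real.exp (-(θ * (σ * L + ε)))) * transfer p B h u ≤ h u)
    (hle : ∀ u, ENNReal.ofReal γ * ‖u‖ₑ ^ (θ * σ) ≤ h u) {u : Plane} (hu : h u ≠ ∞) {M : ℝ}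
    (hM : 0 < M) :
    DecaysExp fun n => bernoulliMeasure p
      {ω | ENNReal.ofReal (M * Real.exp (n * (θ * (σ * L + 2 * ε)))) ≤
        ‖linMap (iterate B n ω) u‖ₑ ^ (θ * σ)} := by
  refine ⟨(h u).toReal / (γ * M), θ * ε, by positivity, fun n _ => ?_⟩
  set E := {ω : ℤ → Fin k | ENNReal.ofReal (M * Real.exp (n * (θ * (σ * L + 2 * ε)))) ≤
    ‖linMap (iterate B n ω) u‖ₑ ^ (θ * σ)}
  have h1 := bernoulliMeasure_le_of_superharmonic hsup n u
    (ENNReal.ofReal γ * ENNReal.ofReal (M * Real.exp (n * (θ * (σ * L + 2 * ε)))))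
  have h2 : bernoulliMeasure p E ≤ bernoulliMeasure p {ω | ENNReal.ofReal γ *
      ENNReal.ofReal (M * Real.exp (n * (θ * (σ * L + 2 * ε)))) ≤ h (linMap (iterate B n ω) u)} :=
    measure_mono fun ω hω => (mul_le_mul_right hω _).trans (hle _)
  have h3 : ENNReal.ofReal (γ * M * Real.exp (θ * ε * n)) * bernoulliMeasure p E ≤ h u := by
    refine le_trans (le_of_eq ?_) ((mul_le_mul_right (mul_le_mul_right h2 _) _).trans h1)
    rw [← mul_assoc, ← ENNReal.ofReal_mul hγ.le, ← ENNReal.ofReal_pow (Real.exp_pos _).le,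
      ← ENNReal.ofReal_mul (by positivity), ← Real.exp_nat_mul]
    congr 2
    rw [mul_left_comm, mul_left_comm _ M, ← Real.exp_add, mul_assoc]
    congr 3
    ring
  have hpos : 0 < γ * M * Real.exp (θ * ε * n) := by positivity
  calc bernoulliMeasure p E
      ≤ h u / ENNReal.ofReal (γ * M * Real.exp (θ * ε * n)) := by
        rw [ENNReal.le_div_iff_mul_le (Or.inl (ENNReal.ofReal_pos.2 hpos).ne')
          (Or.inl ENNReal.ofReal_ne_top), mul_comm]
        exact h3
    _ = _ := by
        rw [← ENNReal.ofReal_toReal hu, ← ENNReal.ofReal_div_of_pos hpos,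
          ENNReal.toReal_ofReal ENNReal.toReal_nonneg, Real.exp_neg]
        congr 1
        field_simp

theorem exists_deviation (hp : ∀ i, 0 < p i) (hS : ∃ i, i ∈ S) (hD : 1 ≤ D)
    (hup : ∀ i u, ‖linMap (B i) u‖ ≤ D * ‖u‖)
    (hlow : ∀ j ∉ S, ∀ u, ‖u‖ ≤ D * ‖linMap (B j) u‖)
    (hr : ∀ i ∈ S, ‖r i‖ = 1) (hB : ∀ i ∈ S, ∀ u, ∃ a : ℝ, linMap (B i) u = a • r i)
    {α : ℝ} (hα : 0 < α)
    (hH : ∀ i ∈ S, ∫⁻ c, ‖c.image B (r i)‖ₑ ^ (-α) ∂(excursionMeasure p S) ≠ ∞) :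
    ∃ L : ℝ, ∀ ε > 0, ∀ M > 0,
      (∀ u, DecaysExp fun n => bernoulliMeasure p
        {ω | ENNReal.ofReal (M * Real.exp (n * (L + ε))) ≤ ‖linMap (iterate B n ω) u‖ₑ}) ∧
      (∀ i ∈ S, ∀ (m : ℕ) (w : Fin m → Fin k), (∀ j, w j ∉ S) →
        DecaysExp fun n => bernoulliMeasure p
          {ω | ‖linMap (iterate B n ω) (linMap (wordProd B m w) (r i))‖ₑ ≤
            ENNReal.ofReal (M * Real.exp (n * (L - ε)))}) := by
  obtain ⟨L, hL⟩ := exists_drift hp hS hD hup hlow hr hB hα hH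
  refine ⟨L, fun ε hε M hM => ⟨fun u => ?_, fun i hi m w hw => ?_⟩⟩
  · obtain ⟨θ, hθ, γ, hγ, h, hsup, hle, -, hfin⟩ := hL 1 (Or.inl rfl) (ε / 2) (by positivity)
    refine (decaysExp_of_superharmonic hθ (by positivity) hγ hsup hle (hfin rfl u)
      (Real.rpow_pos_of_pos hM θ)).mono fun n _ => measure_mono fun ω hω => ?_
    have h1 := ENNReal.rpow_le_rpow (mem_ofPred_eq.mp hω) hθ.le
    rw [ENNReal.ofReal_rpow_of_pos (by positivity), Real.mul_rpow hM.le (Real.exp_pos _).le,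
      ← Real.exp_mul] at h1
    refine le_trans (le_of_eq ?_) (h1.trans (le_of_eq ?_))
    · congr 3; ring
    · rw [mul_one]
  · obtain ⟨θ, hθ, γ, hγ, h, hsup, hle, hfin, -⟩ := hL (-1) (Or.inr rfl) (ε / 2) (by positivity)
    have hu : h (linMap (wordProd B m w) (r i)) ≠ ∞ := by
      refine superharmonic_ne_top (ENNReal.ofReal_pos.2 (Real.exp_pos _)).ne' hsup (hfin i hi) w
        fun j => (hp _).ne'
    refine (decaysExp_of_superharmonic hθ (by positivity) hγ hsup hle hu
      (Real.rpow_pos_of_pos hM (-θ))).mono fun n _ => measure_mono fun ω hω => ?_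
    have h1 := ENNReal.inv_le_inv.2 (ENNReal.rpow_le_rpow (mem_ofPred_eq.mp hω) hθ.le)
    rw [← ENNReal.rpow_neg, ← ENNReal.rpow_neg, ENNReal.ofReal_rpow_of_pos (by positivity),
      Real.mul_rpow hM.le (Real.exp_pos _).le, ← Real.exp_mul] at h1
    refine le_trans (le_of_eq ?_) (h1.trans (le_of_eq ?_))
    · congr 3; ring
    · rw [mul_neg_one]

theorem norm_linMap_le (M : Mat2) :
    ‖linMap M‖ ≤
      ‖linMap M (EuclideanSpace.single 0 1)‖ + ‖linMap M (EuclideanSpace.single 1 1)‖ := by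
  refine ContinuousLinearMap.opNorm_le_bound _ (by positivity) fun u => ?_
  have hu : u = u 0 • EuclideanSpace.single (0 : Fin 2) (1 : ℝ) +
      u 1 • EuclideanSpace.single (1 : Fin 2) (1 : ℝ) := by
    ext i; fin_cases i <;> simp
  have h0 : |u 0| ≤ ‖u‖ := PiLp.norm_apply_le u 0
  have h1 : |u 1| ≤ ‖u‖ := PiLp.norm_apply_le u 1
  conv_lhs => rw [hu, map_add, map_smul, map_smul]
  refine (norm_add_le _ _).trans ?_
  rw [norm_smul, norm_smul, add_mul, mul_comm, mul_comm (‖u 1‖)]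
  exact add_le_add (mul_le_mul_of_nonneg_left h0 (norm_nonneg _))
    (mul_le_mul_of_nonneg_left h1 (norm_nonneg _))

theorem setOf_lt_abs_subset {Ω : Type*} {y : Ω → ℝ≥0∞} {n : ℕ} (hn : 0 < n) {L ε : ℝ} :
    {ω | ENNReal.ofReal ε < (ENNReal.log (y ω) / (n : EReal) - (L : EReal)).abs} ⊆
      {ω | ENNReal.ofReal (Real.exp (n * (L + ε))) ≤ y ω} ∪
        {ω | y ω ≤ ENNReal.ofReal (Real.exp (n * (L - ε)))} := by
  intro ω hω
  by_contra hcon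
  simp only [mem_union, mem_ofPred_eq, not_or, not_le] at hcon
  exact (not_le.2 (mem_ofPred_eq.mp hω)) (abs_log_div_sub_le hn hcon.2.le hcon.1.le)

/-- Large deviations for the norm and for the vectors on the orbits of the singular ranges. -/
theorem exists_lyapunov_decaysExp (hp : ∀ i, 0 < p i) (hS : ∃ i, i ∈ S) (hD : 1 ≤ D)
    (hup : ∀ i u, ‖linMap (B i) u‖ ≤ D * ‖u‖)
    (hlow : ∀ j ∉ S, ∀ u, ‖u‖ ≤ D * ‖linMap (B j) u‖)
    (hr : ∀ i ∈ S, ‖r i‖ = 1) (hB : ∀ i ∈ S, ∀ u, ∃ a : ℝ, linMap (B i) u = a • r i)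
    {α : ℝ} (hα : 0 < α)
    (hH : ∀ i ∈ S, ∫⁻ c, ‖c.image B (r i)‖ₑ ^ (-α) ∂(excursionMeasure p S) ≠ ∞) :
    (∀ ε > 0, DecaysExp fun n => bernoulliMeasure p
      {ω | ENNReal.ofReal ε < (normGrowth B n ω - topLyapunov p B).abs}) ∧
    (∀ ε > 0, ∀ i ∈ S, ∀ (m : ℕ) (w : Fin m → Fin k), (∀ j, w j ∉ S) → ∀ (x : P1) (a : ℝ),
      linMap (wordProd B m w) (r i) = a • x.rep → a ≠ 0 →
      DecaysExp fun n => bernoulliMeasure p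
        {ω | ENNReal.ofReal ε < (vectorGrowth B n ω x - topLyapunov p B).abs}) := by
  obtain ⟨L, hL⟩ := exists_deviation hp hS hD hup hlow hr hB hα hH
  have hnorm : ∀ ε > 0, DecaysExp fun n => bernoulliMeasure p
      {ω | ENNReal.ofReal ε < (normGrowth B n ω - (L : EReal)).abs} := by
    intro ε hε
    obtain ⟨s, hs⟩ := hS
    have h1 := (hL ε hε (1 / 2) (by norm_num)).1 (EuclideanSpace.single 0 1)
    have h2 := (hL ε hε (1 / 2) (by norm_num)).1 (EuclideanSpace.single 1 1)
    have h3 := (hL ε hε 1 one_pos).2 s hs 0 Fin.elim0 (fun j => j.elim0)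
    refine ((h1.add h2).add h3).mono fun n hn => ?_
    refine (measure_mono (setOf_lt_abs_subset hn)).trans ((measure_union_le _ _).trans
      (add_le_add ((measure_mono ?_).trans (measure_union_le _ _)) (measure_mono ?_)))
    · intro ω hω
      by_contra hcon
      simp only [mem_union, mem_ofPred_eq, not_or, not_le, ← ofReal_norm] at hcon hω
      rw [ENNReal.ofReal_lt_ofReal_iff (by positivity),
        ENNReal.ofReal_lt_ofReal_iff (by positivity)] at hcon
      rw [ENNReal.ofReal_le_ofReal_iff (norm_nonneg _)] at hω
      linarith [norm_linMap_le (iterate B n ω)]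
    · intro ω hω
      simp only [mem_ofPred_eq, ← ofReal_norm, wordProd, linMap_one, one_mul] at hω ⊢
      refine (ENNReal.ofReal_le_ofReal ?_).trans hω
      have := (linMap (iterate B n ω)).le_opNorm (r s)
      rwa [hr s hs, mul_one] at this
  rw [topLyapunov_eq_of_decaysExp hnorm]
  refine ⟨hnorm, fun ε hε i hi m w hw x a hx ha => ?_⟩
  set u := linMap (wordProd B m w) (r i) with hu
  have hu0 : 0 < ‖u‖ := by
    rw [hx]; exact norm_pos_iff.2 (smul_ne_zero ha x.rep_nonzero)
  have hrep : ∀ n ω, ‖linMap (iterate B n ω) x.rep‖ₑ / ‖x.rep‖ₑ =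
      ENNReal.ofReal (‖linMap (iterate B n ω) u‖ / ‖u‖) := by
    intro n ω
    have hx0 : 0 < ‖x.rep‖ := norm_pos_iff.2 x.rep_nonzero
    rw [hx, map_smul, norm_smul, norm_smul, mul_div_mul_left _ _ (by simpa using ha),
      ← ofReal_norm, ← ofReal_norm, ENNReal.ofReal_div_of_pos hx0]
  refine (((hL ε hε ‖u‖ hu0).1 u).add ((hL ε hε ‖u‖ hu0).2 i hi m w hw)).mono fun n hn => ?_
  refine (measure_mono (setOf_lt_abs_subset hn)).trans ((measure_union_le _ _).trans
    (add_le_add (measure_mono ?_) (measure_mono ?_)))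
  · intro ω hω
    rw [mem_ofPred_eq, hrep, ENNReal.ofReal_le_ofReal_iff (by positivity),
      le_div_iff₀ hu0] at hω
    rw [mem_ofPred_eq, ← ofReal_norm]
    exact ENNReal.ofReal_le_ofReal (by linarith)
  · intro ω hω
    rw [mem_ofPred_eq, hrep, ENNReal.ofReal_le_ofReal_iff (by positivity),
      div_le_iff₀ hu0] at hω
    rw [mem_ofPred_eq, ← ofReal_norm]
    exact ENNReal.ofReal_le_ofReal (by linarith)

end FixedCocycle

/-! ### Negative moments of a function that winds around zero -/

/-- If the planar curve `(g, f)` turns with positive speed, `f' g - f g' ≥ κ`, then `|f| ^ (-1/2)`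
is integrable, with a polynomial bound in the size of the curve. The derivative of the
(regularized) function `f |f| ^ (-1/2) g` controls `|f| ^ (-1/2)`, so no count of the zeros
of `f` is needed. -/
theorem lintegral_rpow_neg_half_le {f g f' g' : ℝ → ℝ} {a b R κ : ℝ} (hab : a ≤ b) (hR : 1 ≤ R)
    (hκ : 0 < κ) (hfc : ContinuousOn f (Icc a b)) (hgc : ContinuousOn g (Icc a b))
    (hf : ∀ t ∈ Ioo a b, HasDerivAt f (f' t) t) (hg : ∀ t ∈ Ioo a b, HasDerivAt g (g' t) t)
    (hfR : ∀ t ∈ Icc a b, |f t| ≤ R) (hgR : ∀ t ∈ Icc a b, |g t| ≤ R)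
    (hgR' : ∀ t ∈ Ioo a b, |g' t| ≤ R)
    (hw : ∀ t ∈ Ioo a b, κ ≤ f' t * g t - f t * g' t) :
    ∫⁻ t in Icc a b, ‖f t‖ₑ ^ (-(1 / 2) : ℝ) ≤
      ENNReal.ofReal (8 * R ^ 3 / κ * (1 + (b - a))) := by
  -- The regularized negative power.
  set φ : ℝ → ℝ → ℝ := fun δ t => (f t ^ 2 + δ) ^ (-(1 / 4) : ℝ) with hφ
  have hpos : ∀ {δ : ℝ}, 0 < δ → ∀ t, 0 < f t ^ 2 + δ := fun hδ t => by positivity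
  have hφpos : ∀ {δ : ℝ}, 0 < δ → ∀ t, 0 < φ δ t := fun hδ t => Real.rpow_pos_of_pos (hpos hδ t) _
  have hφc : ∀ {δ : ℝ}, 0 < δ → ContinuousOn (φ δ) (Icc a b) := fun hδ =>
    ((hfc.pow 2).add continuousOn_const).rpow_const fun t _ => Or.inl (hpos hδ t).ne'
  have hφf : ∀ {δ : ℝ}, 0 < δ → δ ≤ 1 → ∀ t ∈ Icc a b, φ δ t * |f t| ≤ 2 * R ^ 2 := by
    intro δ hδ hδ1 t ht
    have hx := hpos hδ t
    have h1 : |f t| ≤ (f t ^ 2 + δ) ^ (1 / 2 : ℝ) := by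
      rw [← Real.sqrt_eq_rpow]
      exact Real.abs_le_sqrt (by linarith)
    have h2 : f t ^ 2 + δ ≤ 2 * R ^ 2 := by
      have := sq_le_sq' (abs_le.1 (hfR t ht)).1 (abs_le.1 (hfR t ht)).2
      nlinarith
    have h3 : 1 ≤ 2 * R ^ 2 := by nlinarith
    calc φ δ t * |f t| ≤ φ δ t * (f t ^ 2 + δ) ^ (1 / 2 : ℝ) :=
          mul_le_mul_of_nonneg_left h1 (hφpos hδ t).le
      _ = (f t ^ 2 + δ) ^ (1 / 4 : ℝ) := by
          rw [hφ, ← Real.rpow_add hx]; norm_num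
      _ ≤ (2 * R ^ 2) ^ (1 / 4 : ℝ) := by gcongr
      _ ≤ (2 * R ^ 2) ^ (1 : ℝ) := Real.rpow_le_rpow_of_exponent_le h3 (by norm_num)
      _ = 2 * R ^ 2 := Real.rpow_one _
  have hreg : ∀ δ : ℝ, 0 < δ → δ ≤ 1 →
      ∫⁻ t in Icc a b, ENNReal.ofReal (φ δ t) ≤
        ENNReal.ofReal (8 * R ^ 3 / κ * (1 + (b - a))) := by
    intro δ hδ hδ1
    set F : ℝ → ℝ := fun t => f t * φ δ t * g t with hF
    set F' : ℝ → ℝ := fun t => (f' t * φ δ t + f t * (2 * f t * f' t * (-(1 / 4)) *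
      (f t ^ 2 + δ) ^ (-(1 / 4) - 1 : ℝ))) * g t + f t * φ δ t * g' t with hF'
    have hFd : ∀ t ∈ Ioo a b, HasDerivAt F (F' t) t := by
      intro t ht
      have h1 : HasDerivAt (fun t => f t ^ 2 + δ) (2 * f t * f' t) t := by
        have := ((hf t ht).pow 2).add_const δ
        simpa using this
      have h2 := h1.rpow_const (p := -(1 / 4)) (Or.inl (hpos hδ t).ne')
      exact ((hf t ht).mul h2).mul (hg t ht)
    have hle : ∀ t ∈ Ioo a b, κ / 2 * φ δ t - 4 * R ^ 3 ≤ F' t := by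
      intro t ht
      have hx := hpos hδ t
      have hφ0 := hφpos hδ t
      have h1 : (f t ^ 2 + δ) ^ (-(1 / 4) - 1 : ℝ) = φ δ t / (f t ^ 2 + δ) :=
        Real.rpow_sub_one hx.ne' _
      set l := 1 - 1 / 2 * (f t ^ 2 / (f t ^ 2 + δ)) with hl
      have hq1 : f t ^ 2 / (f t ^ 2 + δ) ≤ 1 := by rw [div_le_one hx]; linarith
      have hq0 : 0 ≤ f t ^ 2 / (f t ^ 2 + δ) := by positivity
      have hF'eq : F' t = l * φ δ t * (f' t * g t - f t * g' t) +
          (1 + l) * (φ δ t * (f t * g' t)) := by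
        simp only [hF', h1, hl]
        field_simp
        ring
      have h2 : -(2 * R ^ 2 * R) ≤ φ δ t * (f t * g' t) := by
        have h3 : |φ δ t * (f t * g' t)| ≤ 2 * R ^ 2 * R := by
          rw [abs_mul, abs_mul, abs_of_pos hφ0, ← mul_assoc]
          exact mul_le_mul (hφf hδ hδ1 t (Ioo_subset_Icc_self ht)) (hgR' t ht) (abs_nonneg _)
            (by positivity)
        exact (abs_le.1 h3).1
      have hl1 : 1 / 2 ≤ l := by rw [hl]; linarith
      have hl2 : l ≤ 1 := by rw [hl]; linarith
      have h4 : κ / 2 * φ δ t ≤ l * φ δ t * (f' t * g t - f t * g' t) := by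
        calc κ / 2 * φ δ t = (1 / 2 * φ δ t) * κ := by ring
          _ ≤ (l * φ δ t) * (f' t * g t - f t * g' t) :=
            mul_le_mul (mul_le_mul_of_nonneg_right hl1 hφ0.le) (hw t ht) hκ.le
              (mul_nonneg (by linarith) hφ0.le)
      have h5 : -(4 * R ^ 3) ≤ (1 + l) * (φ δ t * (f t * g' t)) := by
        calc -(4 * R ^ 3) = 2 * -(2 * R ^ 2 * R) := by ring
          _ ≤ (1 + l) * -(2 * R ^ 2 * R) := by
            have : 0 ≤ 2 * R ^ 2 * R := by positivity
            nlinarith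
          _ ≤ _ := mul_le_mul_of_nonneg_left h2 (by linarith)
      rw [hF'eq]
      linarith
    have hFR : ∀ t ∈ Icc a b, |F t| ≤ 2 * R ^ 3 := by
      intro t ht
      rw [hF, abs_mul, abs_mul, abs_of_pos (hφpos hδ t), mul_comm |f t|]
      calc φ δ t * |f t| * |g t| ≤ 2 * R ^ 2 * R :=
            mul_le_mul (hφf hδ hδ1 t ht) (hgR t ht) (abs_nonneg _) (by positivity)
        _ = 2 * R ^ 3 := by ring
    have hint : IntegrableOn (φ δ) (Icc a b) := (hφc hδ).integrableOn_compact isCompact_Icc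
    have hint2 : IntegrableOn (fun t => κ / 2 * φ δ t - 4 * R ^ 3) (Icc a b) :=
      (hint.const_mul _).sub (integrable_const _)
    have hmain := intervalIntegral.integral_le_sub_of_hasDeriv_right_of_le hab
      ((hfc.mul (hφc hδ)).mul hgc) (fun t ht => (hFd t ht).hasDerivWithinAt) hint2 hle
    rw [intervalIntegral.integral_sub
      (((intervalIntegrable_iff_integrableOn_Icc_of_le hab).2 hint).const_mul _)
      intervalIntegrable_const, intervalIntegral.integral_const_mul,
      intervalIntegral.integral_const, smul_eq_mul] at hmain
    have hb := abs_le.1 (hFR b (right_mem_Icc.2 hab))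
    have ha := abs_le.1 (hFR a (left_mem_Icc.2 hab))
    have hfin : ∫ t in a..b, φ δ t ≤ 8 * R ^ 3 / κ * (1 + (b - a)) := by
      rw [div_mul_eq_mul_div, le_div_iff₀ hκ]
      simp only [hF] at ha hb
      simp only [Pi.mul_apply] at hmain
      linarith [hmain]
    rw [← ofReal_integral_eq_lintegral_ofReal hint
      (Eventually.of_forall fun t => (hφpos hδ t).le), integral_Icc_eq_integral_Ioc,
      ← intervalIntegral.integral_of_le hab]
    exact ENNReal.ofReal_le_ofReal hfin
  have hlim : ∀ t, Tendsto (fun n : ℕ => ENNReal.ofReal (φ (1 / ((n : ℝ) + 1)) t)) atTop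
      (𝓝 (‖f t‖ₑ ^ (-(1 / 2) : ℝ))) := by
    intro t
    have h1 : ∀ n : ℕ, ENNReal.ofReal (φ (1 / ((n : ℝ) + 1)) t) =
        ENNReal.ofReal (f t ^ 2 + 1 / ((n : ℝ) + 1)) ^ (-(1 / 4) : ℝ) := fun n =>
      (ENNReal.ofReal_rpow_of_pos (hpos (by positivity) t)).symm
    have h2 : ‖f t‖ₑ ^ (-(1 / 2) : ℝ) = ENNReal.ofReal (f t ^ 2 + 0) ^ (-(1 / 4) : ℝ) := by
      rw [add_zero, ← sq_abs, ENNReal.ofReal_pow (abs_nonneg _), ← Real.norm_eq_abs, ofReal_norm,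
        ← ENNReal.rpow_natCast, ← ENNReal.rpow_mul]
      norm_num
    simp only [h1, h2]
    refine (ENNReal.continuous_rpow_const.tendsto _).comp
      ((ENNReal.continuous_ofReal.tendsto _).comp ?_)
    exact tendsto_const_nhds.add tendsto_one_div_add_atTop_nhds_zero_nat
  calc ∫⁻ t in Icc a b, ‖f t‖ₑ ^ (-(1 / 2) : ℝ)
      = ∫⁻ t in Icc a b, liminf (fun n : ℕ => ENNReal.ofReal (φ (1 / ((n : ℝ) + 1)) t)) atTop :=
        lintegral_congr fun t => (hlim t).liminf_eq.symm
    _ ≤ liminf (fun n : ℕ => ∫⁻ t in Icc a b, ENNReal.ofReal (φ (1 / ((n : ℝ) + 1)) t)) atTop :=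
        lintegral_liminf_le' fun n =>
          ((hφc (by positivity)).aemeasurable measurableSet_Icc).ennreal_ofReal
    _ ≤ _ := by
        refine liminf_le_of_le (by isBoundedDefault) fun c hc => ?_
        obtain ⟨n, hn⟩ := hc.exists
        refine hn.trans (hreg _ (by positivity) ?_)
        rw [div_le_one (by positivity)]
        linarith [(n.cast_nonneg : (0 : ℝ) ≤ n)]

/-- Interpolation between the exponents `0` and `1`. -/
theorem rpow_le_mul_one_add_div {x K : ℝ≥0∞} (hK0 : K ≠ 0) (hK : K ≠ ∞) {β : ℝ} (hβ0 : 0 ≤ β)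
    (hβ1 : β ≤ 1) : x ^ β ≤ K ^ β * (1 + x / K) := by
  rcases le_total x K with h | h
  · calc x ^ β ≤ K ^ β := ENNReal.rpow_le_rpow h hβ0
      _ = K ^ β * 1 := (mul_one _).symm
      _ ≤ _ := mul_le_mul_right le_self_add _
  · have h1 : 1 ≤ x / K := by
      rw [ENNReal.le_div_iff_mul_le (Or.inl hK0) (Or.inl hK), one_mul]; exact h
    calc x ^ β = (K * (x / K)) ^ β := by rw [ENNReal.mul_div_cancel hK0 hK]
      _ = K ^ β * (x / K) ^ β := ENNReal.mul_rpow_of_nonneg _ _ hβ0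
      _ ≤ K ^ β * (x / K) ^ (1 : ℝ) := by gcongr
      _ ≤ _ := by rw [ENNReal.rpow_one]; exact mul_le_mul_right le_add_self _

/-! ### Winding of the orbits of the singular ranges -/

theorem linMap_apply (M : Mat2) (u : Plane) (x : Fin 2) :
    linMap M u x = M x 0 * u 0 + M x 1 * u 1 := by
  have : linMap M u = WithLp.toLp 2 (M.mulVec (WithLp.ofLp u)) := by
    rw [linMap, ← Matrix.toEuclideanCLM_toLp]
  rw [this]
  simp [Matrix.mulVec, dotProduct, Fin.sum_univ_two]

theorem wedge_linMap (M : Mat2) (u v : Plane) :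
    wedge (linMap M u) (linMap M v) = M.det * wedge u v := by
  simp only [wedge, linMap_apply, Matrix.det_fin_two]; ring

theorem wedge_add_right (u v w : Plane) : wedge u (v + w) = wedge u v + wedge u w := by
  simp only [wedge, PiLp.add_apply]; ring

theorem norm_sq_plane (u : Plane) : ‖u‖ ^ 2 = u 0 ^ 2 + u 1 ^ 2 := by
  simp [EuclideanSpace.norm_sq_eq, Fin.sum_univ_two]

theorem abs_apply_le_norm (u : Plane) (x : Fin 2) : |u x| ≤ ‖u‖ := PiLp.norm_apply_le u x

theorem continuous_linMap : Continuous linMap := by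
  let l : Mat2 →ₗ[ℝ] (Plane →L[ℝ] Plane) :=
    { toFun := linMap
      map_add' := fun x y => by simp [linMap]
      map_smul' := fun c x => by simp [linMap] }
  exact l.continuous_of_finiteDimensional

theorem continuousOn_wordProd {A : ℝ → Fin k → Mat2} {s : Set ℝ}
    (hc : ∀ i, ContinuousOn (fun t => A t i) s) (n : ℕ) (w : Fin n → Fin k) :
    ContinuousOn (fun t => wordProd (A t) n w) s := by
  induction n with
  | zero => exact continuousOn_const
  | succ n ih => exact (hc _).mul (ih _)

theorem continuousOn_linMap_apply {M : ℝ → Mat2} {s : Set ℝ} (hM : ContinuousOn M s) (u : Plane) :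
    ContinuousOn (fun t => linMap (M t) u) s :=
  (continuous_linMap.comp_continuousOn hM).clm_apply continuousOn_const

/-- The derivative in `t` of the image of `r` under the product of `A t` along a word, where
`dA t` is the derivative of `A t`. -/
noncomputable def wordDeriv (A dA : ℝ → Fin k → Mat2) (r : Plane) (t : ℝ) :
    (n : ℕ) → (Fin n → Fin k) → Plane
  | 0, _ => 0
  | n + 1, w => linMap (dA t (w (Fin.last n))) (linMap (wordProd (A t) n (Fin.init w)) r) +
      linMap (A t (w (Fin.last n))) (wordDeriv A dA r t n (Fin.init w))

section Family

variable {A dA : ℝ → Fin k → Mat2} {S : Finset (Fin k)} {D κ t : ℝ}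

theorem hasDerivAt_wordProd
    (hd : ∀ i x y, HasDerivAt (fun s => A s i x y) (dA t i x y) t) (r : Plane) (n : ℕ)
    (w : Fin n → Fin k) (x : Fin 2) :
    HasDerivAt (fun s => linMap (wordProd (A s) n w) r x) (wordDeriv A dA r t n w x) t := by
  induction n generalizing x with
  | zero => simpa [wordProd, wordDeriv] using hasDerivAt_const t (linMap 1 r x)
  | succ n ih =>
    simp only [wordProd, wordDeriv, linMap_mul, PiLp.add_apply]
    simp only [linMap_apply _ (linMap (wordProd _ _ _) r), linMap_apply _ (wordDeriv _ _ _ _ _ _)]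
    have h0 := (hd (w (Fin.last n)) x 0).mul (ih (Fin.init w) 0)
    have h1 := (hd (w (Fin.last n)) x 1).mul (ih (Fin.init w) 1)
    refine (h0.add h1).congr_deriv ?_
    ring

theorem norm_add_norm_wordDeriv_le (hD : 0 ≤ D) (hup : ∀ i u, ‖linMap (A t i) u‖ ≤ D * ‖u‖)
    (hdup : ∀ i u, ‖linMap (dA t i) u‖ ≤ D * ‖u‖) (r : Plane) (n : ℕ) (w : Fin n → Fin k) :
    ‖linMap (wordProd (A t) n w) r‖ + ‖wordDeriv A dA r t n w‖ ≤ (2 * D) ^ n * ‖r‖ := by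
  induction n with
  | zero => simp [wordProd, wordDeriv, linMap_one]
  | succ n ih =>
    simp only [wordProd, wordDeriv, linMap_mul]
    set u := linMap (wordProd (A t) n (Fin.init w)) r
    set u' := wordDeriv A dA r t n (Fin.init w)
    have h1 := ih (Fin.init w)
    have h2 := hup (w (Fin.last n)) u
    have h3 := hdup (w (Fin.last n)) u
    have h4 := hup (w (Fin.last n)) u'
    have h5 := norm_add_le (linMap (dA t (w (Fin.last n))) u) (linMap (A t (w (Fin.last n))) u')
    have h6 : 2 * D * (‖u‖ + ‖u'‖) ≤ 2 * D * ((2 * D) ^ n * ‖r‖) :=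
      mul_le_mul_of_nonneg_left h1 (by positivity)
    rw [pow_succ', mul_assoc]
    have h7 : 0 ≤ D * ‖u'‖ := by positivity
    linarith

theorem wedge_wordDeriv_nonneg (hκ : 0 ≤ κ) (hdet : ∀ j ∉ S, 0 < (A t j).det)
    (hw : ∀ j ∉ S, ∀ v, κ * ‖linMap (A t j) v‖ ^ 2 ≤
      wedge (linMap (A t j) v) (linMap (dA t j) v)) (r : Plane) (n : ℕ)
    {w : Fin n → Fin k} (hwS : ∀ j, w j ∉ S) :
    0 ≤ wedge (linMap (wordProd (A t) n w) r) (wordDeriv A dA r t n w) := by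
  induction n with
  | zero => simp [wordDeriv, wedge]
  | succ n ih =>
    simp only [wordProd, wordDeriv, linMap_mul]
    rw [wedge_add_right, wedge_linMap]
    exact add_nonneg (le_trans (by positivity) (hw _ (hwS _) _))
      (mul_nonneg (hdet _ (hwS _)).le (ih fun j => hwS _))

/-- A nonempty product turns at least as fast as its last factor, since the factors preserve the
orientation. -/
theorem le_wedge_wordDeriv (hκ : 0 ≤ κ) (hdet : ∀ j ∉ S, 0 < (A t j).det)
    (hw : ∀ j ∉ S, ∀ v, κ * ‖linMap (A t j) v‖ ^ 2 ≤
      wedge (linMap (A t j) v) (linMap (dA t j) v)) (r : Plane) (n : ℕ)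
    {w : Fin (n + 1) → Fin k} (hwS : ∀ j, w j ∉ S) :
    κ * ‖linMap (wordProd (A t) (n + 1) w) r‖ ^ 2 ≤
      wedge (linMap (wordProd (A t) (n + 1) w) r) (wordDeriv A dA r t (n + 1) w) := by
  simp only [wordProd, wordDeriv, linMap_mul]
  rw [wedge_add_right, wedge_linMap]
  have h1 := hw _ (hwS (Fin.last n)) (linMap (wordProd (A t) n (Fin.init w)) r)
  have h2 : 0 ≤ wedge (linMap (wordProd (A t) n (Fin.init w)) r)
      (wordDeriv A dA r t n (Fin.init w)) := wedge_wordDeriv_nonneg hκ hdet hw r n fun j => hwS _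
  have h3 := mul_nonneg (hdet _ (hwS (Fin.last n))).le h2
  linarith

end Family

/-- The value at `u` of the functional with coefficients `φ`. -/
def pairing (φ u : Plane) : ℝ := φ 0 * u 0 + φ 1 * u 1

theorem abs_pairing_le (φ u : Plane) : |pairing φ u| ≤ 2 * ‖φ‖ * ‖u‖ := by
  have h0 : |φ 0 * u 0| ≤ ‖φ‖ * ‖u‖ := by
    rw [abs_mul]
    exact mul_le_mul (abs_apply_le_norm _ _) (abs_apply_le_norm _ _) (abs_nonneg _) (norm_nonneg _)
  have h1 : |φ 1 * u 1| ≤ ‖φ‖ * ‖u‖ := by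
    rw [abs_mul]
    exact mul_le_mul (abs_apply_le_norm _ _) (abs_apply_le_norm _ _) (abs_nonneg _) (norm_nonneg _)
  have := abs_add_le (φ 0 * u 0) (φ 1 * u 1)
  rw [pairing]
  linarith

section Family

variable {A dA : ℝ → Fin k → Mat2} {S : Finset (Fin k)} {D κ a b : ℝ}

/-- The negative moment of order `1/2` over the parameter of a functional of the image of `r` along
a word grows at most exponentially with the length of the word. -/
theorem exists_lintegral_pairing_le (hab : a ≤ b) (hD : 1 ≤ D) (hκ : 0 < κ)
    (hc : ∀ i, ContinuousOn (fun t => A t i) (Icc a b))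
    (hd : ∀ t ∈ Ioo a b, ∀ i x y, HasDerivAt (fun s => A s i x y) (dA t i x y) t)
    (hup : ∀ t ∈ Icc a b, ∀ i u, ‖linMap (A t i) u‖ ≤ D * ‖u‖)
    (hdup : ∀ t ∈ Icc a b, ∀ i u, ‖linMap (dA t i) u‖ ≤ D * ‖u‖)
    (hlow : ∀ t ∈ Icc a b, ∀ j ∉ S, ∀ u, ‖u‖ ≤ D * ‖linMap (A t j) u‖)
    (hdet : ∀ t ∈ Icc a b, ∀ j ∉ S, 0 < (A t j).det)
    (hw : ∀ t ∈ Icc a b, ∀ j ∉ S, ∀ v, κ * ‖linMap (A t j) v‖ ^ 2 ≤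
      wedge (linMap (A t j) v) (linMap (dA t j) v))
    {r φ : Plane} (hr : ‖r‖ = 1) (hφr : pairing φ r ≠ 0) :
    ∃ E : ℝ, 1 ≤ E ∧ ∀ (n : ℕ) (w : Fin n → Fin k), (∀ j, w j ∉ S) →
      ∫⁻ t in Icc a b, ‖pairing φ (linMap (wordProd (A t) n w) r)‖ₑ ^ (-(1 / 2) : ℝ) ≤
        ENNReal.ofReal (E ^ (n + 1)) := by
  have hφ0 : 0 < ‖φ‖ := by
    refine norm_pos_iff.2 fun h => hφr ?_
    simp [pairing, h]
  have hD0 : 0 < D := by linarith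
  -- `E₀` is the bound for the empty word; for `n + 1` letters the curve has size
  -- `C * (2 * D) ^ (n + 1)` and turns with speed `‖φ‖ ^ 2 * κ * D ^ (-2 * (n + 1))`.
  set C : ℝ := 2 * ‖φ‖ + 1 with hC
  set E₀ : ℝ := |pairing φ r| ^ (-(1 / 2) : ℝ) * (b - a)
  set E₁ : ℝ := 8 * C ^ 3 / (‖φ‖ ^ 2 * κ) * (1 + (b - a))
  set E₂ : ℝ := (2 * D) ^ 3 * D ^ 2
  have hE₀ : 0 ≤ E₀ := mul_nonneg (by positivity) (by linarith)
  have hE₁ : 0 ≤ E₁ := mul_nonneg (by positivity) (by linarith)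
  have hE₂ : 0 ≤ E₂ := by positivity
  set E : ℝ := 1 + E₀ + E₁ + E₂ with hE
  refine ⟨E, by linarith, fun n w hwS => ?_⟩
  cases n with
  | zero =>
    simp only [wordProd, linMap_one, zero_add, pow_one]
    rw [setLIntegral_const, Real.volume_Icc, ← ofReal_norm, Real.norm_eq_abs,
      ENNReal.ofReal_rpow_of_pos (abs_pos.2 hφr), ← ENNReal.ofReal_mul (by positivity)]
    exact ENNReal.ofReal_le_ofReal (by linarith)
  | succ n =>
    set u : ℝ → Plane := fun t => linMap (wordProd (A t) (n + 1) w) r with hu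
    set u' : ℝ → Plane := fun t => wordDeriv A dA r t (n + 1) w with hu'
    set ψ : Plane := !₂[φ 1, -φ 0] with hψ
    have hψ0 : ψ 0 = φ 1 := by simp [hψ]
    have hψ1 : ψ 1 = -φ 0 := by simp [hψ]
    have hψn : ‖ψ‖ = ‖φ‖ := by
      rw [← sq_eq_sq₀ (norm_nonneg _) (norm_nonneg _), norm_sq_plane, norm_sq_plane, hψ0, hψ1]
      ring
    set R : ℝ := C * (2 * D) ^ (n + 1) with hR
    have hDpow : 1 ≤ (2 * D) ^ (n + 1) := one_le_pow₀ (by linarith)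
    have hR1 : 1 ≤ R := one_le_mul_of_one_le_of_one_le (by rw [hC]; linarith) hDpow
    have hsum : ∀ t ∈ Icc a b, ‖u t‖ + ‖u' t‖ ≤ (2 * D) ^ (n + 1) := fun t ht => by
      have := norm_add_norm_wordDeriv_le hD0.le (hup t ht) (hdup t ht) r (n + 1) w
      rwa [hr, mul_one] at this
    have hbound : ∀ (χ v : Plane), ‖χ‖ = ‖φ‖ → ‖v‖ ≤ (2 * D) ^ (n + 1) → |pairing χ v| ≤ R := by
      intro χ v hχ hv
      refine (abs_pairing_le χ v).trans ?_
      rw [hχ, hR]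
      exact mul_le_mul (by rw [hC]; linarith) hv (norm_nonneg _) (by positivity)
    have huc : ContinuousOn u (Icc a b) :=
      continuousOn_linMap_apply (continuousOn_wordProd hc _ _) r
    have hpc : ∀ χ, ContinuousOn (fun t => pairing χ (u t)) (Icc a b) := fun χ =>
      (continuousOn_const.mul ((PiLp.continuous_apply 2 _ 0).comp_continuousOn huc)).add
        (continuousOn_const.mul ((PiLp.continuous_apply 2 _ 1).comp_continuousOn huc))
    have hpd : ∀ χ, ∀ t ∈ Ioo a b,
        HasDerivAt (fun t => pairing χ (u t)) (pairing χ (u' t)) t := fun χ t ht =>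
      ((hasDerivAt_wordProd (hd t ht) r (n + 1) w 0).const_mul _).add
        ((hasDerivAt_wordProd (hd t ht) r (n + 1) w 1).const_mul _)
    have hDn : 0 < D ^ (n + 1) := by positivity
    have hlown : ∀ t ∈ Icc a b, 1 / D ^ (n + 1) ≤ ‖u t‖ := by
      intro t ht
      have := le_norm_wordProd hD0.le (hlow t ht) hwS r
      rw [hr] at this
      rw [div_le_iff₀ hDn]; linarith
    have hwind : ∀ t ∈ Ioo a b, ‖φ‖ ^ 2 * (κ * (1 / D ^ (n + 1)) ^ 2) ≤
        pairing φ (u' t) * pairing ψ (u t) - pairing φ (u t) * pairing ψ (u' t) := by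
      intro t ht
      have ht' := Ioo_subset_Icc_self ht
      have h1 : pairing φ (u' t) * pairing ψ (u t) - pairing φ (u t) * pairing ψ (u' t) =
          ‖φ‖ ^ 2 * wedge (u t) (u' t) := by
        rw [norm_sq_plane, pairing, pairing, pairing, pairing, hψ0, hψ1, wedge]; ring
      rw [h1]
      refine mul_le_mul_of_nonneg_left (le_trans ?_
        (le_wedge_wordDeriv hκ.le (hdet t ht') (hw t ht') r n hwS)) (by positivity)
      have := hlown t ht'
      gcongr
    have hmain := lintegral_rpow_neg_half_le hab hR1 (by positivity) (hpc φ) (hpc ψ)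
      (hpd φ) (hpd ψ)
      (fun t ht => hbound φ _ rfl (by linarith [hsum t ht, norm_nonneg (u' t)]))
      (fun t ht => hbound ψ _ hψn (by linarith [hsum t ht, norm_nonneg (u' t)]))
      (fun t ht => hbound ψ _ hψn
        (by linarith [hsum t (Ioo_subset_Icc_self ht), norm_nonneg (u t)]))
      hwind
    refine hmain.trans (ENNReal.ofReal_le_ofReal ?_)
    have h1 : 8 * R ^ 3 / (‖φ‖ ^ 2 * (κ * (1 / D ^ (n + 1)) ^ 2)) * (1 + (b - a)) =
        E₂ ^ (n + 1) * E₁ := by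
      have h2 : E₂ ^ (n + 1) = ((2 * D) ^ (n + 1)) ^ 3 * (D ^ (n + 1)) ^ 2 := by
        rw [mul_pow, pow_right_comm _ 3, pow_right_comm _ 2]
      rw [h2, hR]
      simp only [E₁]
      have hy := hDn.ne'
      generalize (2 * D) ^ (n + 1) = x
      generalize D ^ (n + 1) = y at hy
      field_simp
    rw [h1, pow_succ E (n + 1)]
    have h2 : E₂ ≤ E := by linarith
    have h3 : E₁ ≤ E := by linarith
    gcongr

/-- For almost every parameter the logarithmic growth over an excursion has exponential moments. -/
theorem exists_ae_lintegral_image_ne_top {p : PMF (Fin k)} (hp : ∀ i, 0 < p i)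
    (hS : ∃ i, i ∈ S) (hab : a ≤ b) (hD : 1 ≤ D) (hκ : 0 < κ)
    (hc : ∀ i, ContinuousOn (fun t => A t i) (Icc a b))
    (hd : ∀ t ∈ Ioo a b, ∀ i x y, HasDerivAt (fun s => A s i x y) (dA t i x y) t)
    (hup : ∀ t ∈ Icc a b, ∀ i u, ‖linMap (A t i) u‖ ≤ D * ‖u‖)
    (hdup : ∀ t ∈ Icc a b, ∀ i u, ‖linMap (dA t i) u‖ ≤ D * ‖u‖)
    (hlow : ∀ t ∈ Icc a b, ∀ j ∉ S, ∀ u, ‖u‖ ≤ D * ‖linMap (A t j) u‖)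
    (hdet : ∀ t ∈ Icc a b, ∀ j ∉ S, 0 < (A t j).det)
    (hw : ∀ t ∈ Icc a b, ∀ j ∉ S, ∀ v, κ * ‖linMap (A t j) v‖ ^ 2 ≤
      wedge (linMap (A t j) v) (linMap (dA t j) v))
    {r φ : Fin k → Plane} (hr : ∀ i ∈ S, ‖r i‖ = 1)
    (hA : ∀ t ∈ Icc a b, ∀ i ∈ S, ∀ v, linMap (A t i) v = pairing (φ i) v • r i)
    (hφr : ∀ i ∈ S, ∀ j ∈ S, pairing (φ j) (r i) ≠ 0) :
    ∃ α : ℝ, 0 < α ∧ ∀ᵐ t ∂(volume.restrict (Icc a b)), ∀ s ∈ S,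
      ∫⁻ c, ‖c.image (A t) (r s)‖ₑ ^ (-α) ∂(excursionMeasure p S) ≠ ∞ := by
  have hE : ∀ s ∈ S, ∀ i ∈ S, ∃ E : ℝ, 1 ≤ E ∧ ∀ (n : ℕ) (w : Fin n → Fin k), (∀ j, w j ∉ S) →
      ∫⁻ t in Icc a b, ‖pairing (φ i) (linMap (wordProd (A t) n w) (r s))‖ₑ ^ (-(1 / 2) : ℝ) ≤
        ENNReal.ofReal (E ^ (n + 1)) := fun s hs i hi =>
    exists_lintegral_pairing_le hab hD hκ hc hd hup hdup hlow hdet hw (hr s hs) (hφr s hs i hi)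
  choose! E hE1 hEw using hE
  -- One constant for all pairs of singular letters.
  set E' : ℝ := 1 + ∑ s, ∑ i, |E s i| with hE'
  have hE'1 : 1 ≤ E' := le_add_of_nonneg_right (by positivity)
  have hEE' : ∀ s i, |E s i| ≤ E' := by
    intro s i
    have h1 := Finset.single_le_sum (f := fun i => |E s i|) (fun _ _ => abs_nonneg _)
      (Finset.mem_univ i)
    have h2 := Finset.single_le_sum (f := fun s => ∑ i, |E s i|)
      (fun _ _ => Finset.sum_nonneg fun _ _ => abs_nonneg _) (Finset.mem_univ s)
    linarith
  obtain ⟨β', hβ', hlt'⟩ := exists_rpow_mul_lt_one (invMass_lt_one hp hS) hE'1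
  set β := min β' 1 with hβdef
  have hβ : 0 < β := lt_min hβ' one_pos
  have hlt : invMass p S * ENNReal.ofReal (E' ^ β) < 1 := by
    refine lt_of_le_of_lt (mul_le_mul_right (ENNReal.ofReal_le_ofReal ?_) _) hlt'
    exact Real.rpow_le_rpow_of_exponent_le hE'1 (min_le_left _ _)
  refine ⟨1 / 2 * β, by positivity, (ae_ball_iff (Finset.countable_toSet S)).2 fun s hs => ?_⟩
  have himage : ∀ (n : ℕ) (w : Fin n → Fin k) (i : Fin k),
      ContinuousOn (fun t => Excursion.image (A t) (r s) ⟨n, w, i⟩) (Icc a b) := fun n w i =>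
    (continuous_linMap.comp_continuousOn (hc i)).clm_apply
      (continuousOn_linMap_apply (continuousOn_wordProd hc n w) (r s))
  have hmeas : ∀ (n : ℕ) (w : Fin n → Fin k) (i : Fin k), AEMeasurable
      (fun t => (∏ j, invWeight p S (w j)) * singWeight p S i *
        ‖Excursion.image (A t) (r s) ⟨n, w, i⟩‖ₑ ^ (-(1 / 2 * β))) (volume.restrict (Icc a b)) :=
    fun n w i => (((himage n w i).aemeasurable measurableSet_Icc).enorm.pow_const _).const_mul _
  have hmeas1 : ∀ (n : ℕ) (w : Fin n → Fin k), AEMeasurable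
      (fun t => ∑ i, (∏ j, invWeight p S (w j)) * singWeight p S i *
        ‖Excursion.image (A t) (r s) ⟨n, w, i⟩‖ₑ ^ (-(1 / 2 * β))) (volume.restrict (Icc a b)) :=
    fun n w => Finset.aemeasurable_fun_sum _ fun i _ => hmeas n w i
  have hmeas2 : ∀ n : ℕ, AEMeasurable
      (fun t => ∑ w : Fin n → Fin k, ∑ i, (∏ j, invWeight p S (w j)) * singWeight p S i *
        ‖Excursion.image (A t) (r s) ⟨n, w, i⟩‖ₑ ^ (-(1 / 2 * β))) (volume.restrict (Icc a b)) :=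
    fun n => Finset.aemeasurable_fun_sum _ fun w _ => hmeas1 n w
  have hterm : ∀ (n : ℕ) (w : Fin n → Fin k) (i : Fin k),
      ∫⁻ t in Icc a b, (∏ j, invWeight p S (w j)) * singWeight p S i *
        ‖Excursion.image (A t) (r s) ⟨n, w, i⟩‖ₑ ^ (-(1 / 2 * β)) ≤
      (∏ j, invWeight p S (w j)) * singWeight p S i *
        (ENNReal.ofReal (E' ^ β) ^ (n + 1) * ENNReal.ofReal (b - a + 1)) := by
    intro n w i
    by_cases hi : i ∈ S
    swap
    · simp [singWeight, hi]
    by_cases hwS : ∀ j, w j ∉ S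
    swap
    · push Not at hwS
      obtain ⟨j, hj⟩ := hwS
      have : ∏ j, invWeight p S (w j) = 0 :=
        Finset.prod_eq_zero (Finset.mem_univ j) (by simp [invWeight, hj])
      simp [this]
    rw [lintegral_const_mul'' _ (((himage n w i).aemeasurable measurableSet_Icc).enorm.pow_const _)]
    refine mul_le_mul_right ?_ _
    set K : ℝ≥0∞ := ENNReal.ofReal (E' ^ (n + 1)) with hK
    have hK0 : K ≠ 0 := (ENNReal.ofReal_pos.2 (by positivity)).ne'
    have hKβ : K ^ β = ENNReal.ofReal (E' ^ β) ^ (n + 1) := by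
      rw [hK, ENNReal.ofReal_rpow_of_pos (by positivity), ← ENNReal.ofReal_pow (by positivity),
        ← Real.rpow_natCast, ← Real.rpow_natCast, ← Real.rpow_mul (by positivity),
        ← Real.rpow_mul (by positivity), mul_comm]
    have hint : ∫⁻ t in Icc a b, ‖Excursion.image (A t) (r s) ⟨n, w, i⟩‖ₑ ^ (-(1 / 2) : ℝ) ≤ K := by
      refine le_trans (le_of_eq (setLIntegral_congr_fun measurableSet_Icc fun t ht => ?_))
        ((hEw s hs i hi n w hwS).trans (ENNReal.ofReal_le_ofReal ?_))
      · have h1 : ‖r i‖ₑ = 1 := by rw [← ofReal_norm, hr i hi, ENNReal.ofReal_one]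
        simp only [Excursion.image, hA t ht i hi, enorm_smul, h1, mul_one]
      · have := hE1 s hs i hi
        exact pow_le_pow_left₀ (by linarith) ((le_abs_self _).trans (hEE' s i)) _
    calc ∫⁻ t in Icc a b, ‖Excursion.image (A t) (r s) ⟨n, w, i⟩‖ₑ ^ (-(1 / 2 * β))
        ≤ ∫⁻ t in Icc a b, K ^ β *
            (1 + ‖Excursion.image (A t) (r s) ⟨n, w, i⟩‖ₑ ^ (-(1 / 2) : ℝ) / K) := by
          refine lintegral_mono fun t => ?_
          rw [← neg_mul, ENNReal.rpow_mul]
          exact rpow_le_mul_one_add_div hK0 ENNReal.ofReal_ne_top hβ.le (min_le_right _ _)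
      _ = K ^ β * (ENNReal.ofReal (b - a) +
            (∫⁻ t in Icc a b, ‖Excursion.image (A t) (r s) ⟨n, w, i⟩‖ₑ ^ (-(1 / 2) : ℝ)) / K) := by
          rw [lintegral_const_mul' _ _ (ENNReal.rpow_ne_top_of_nonneg hβ.le ENNReal.ofReal_ne_top),
            lintegral_add_left measurable_const, setLIntegral_const, Real.volume_Icc, one_mul]
          simp only [div_eq_mul_inv]
          rw [lintegral_mul_const' _ _ (ENNReal.inv_ne_top.2 hK0)]
      _ ≤ K ^ β * (ENNReal.ofReal (b - a) + 1) := by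
          gcongr
          exact ENNReal.div_le_of_le_mul (by rwa [one_mul])
      _ = _ := by
          rw [hKβ, ENNReal.ofReal_add (by linarith) one_pos.le, ENNReal.ofReal_one]
  have hfin : ∫⁻ t in Icc a b, ∫⁻ c, ‖c.image (A t) (r s)‖ₑ ^ (-(1 / 2 * β))
      ∂(excursionMeasure p S) ≠ ∞ := by
    simp only [lintegral_excursionMeasure]
    rw [lintegral_tsum hmeas2]
    have hle : ∀ n : ℕ, ∫⁻ t in Icc a b, ∑ w : Fin n → Fin k, ∑ i,
        (∏ j, invWeight p S (w j)) * singWeight p S i *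
          ‖Excursion.image (A t) (r s) ⟨n, w, i⟩‖ₑ ^ (-(1 / 2 * β)) ≤
        (invMass p S * ENNReal.ofReal (E' ^ β)) ^ n * ((∑ i, singWeight p S i) *
          (ENNReal.ofReal (E' ^ β) * ENNReal.ofReal (b - a + 1))) := by
      intro n
      rw [lintegral_finsetSum' _ fun w _ => hmeas1 n w]
      simp only [lintegral_finsetSum' _ fun i _ => hmeas n _ i]
      refine (Finset.sum_le_sum fun w _ => Finset.sum_le_sum fun i _ => hterm n w i).trans
        (le_of_eq ?_)
      rw [mul_pow, invMass, Fintype.sum_pow, Finset.sum_mul, Finset.sum_mul]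
      refine Finset.sum_congr rfl fun w _ => ?_
      rw [Finset.sum_mul, Finset.mul_sum]
      exact Finset.sum_congr rfl fun i _ => by ring
    refine ne_top_of_le_ne_top ?_ (ENNReal.tsum_le_tsum hle)
    rw [ENNReal.tsum_mul_right]
    refine ENNReal.mul_ne_top (tsum_geometric_ne_top hlt) (ENNReal.mul_ne_top ?_
      (ENNReal.mul_ne_top ENNReal.ofReal_ne_top ENNReal.ofReal_ne_top))
    exact ne_top_of_le_ne_top ENNReal.one_ne_top ((invMass_add p S) ▸ le_add_self)
  have hmeas3 : AEMeasurable (fun t => ∫⁻ c, ‖c.image (A t) (r s)‖ₑ ^ (-(1 / 2 * β))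
      ∂(excursionMeasure p S)) (volume.restrict (Icc a b)) := by
    simp only [lintegral_excursionMeasure]
    exact AEMeasurable.tsum hmeas2
  filter_upwards [ae_lt_top' hmeas3 hfin] with t ht
  exact ht.ne

end Family

/-! ### Rank one matrices -/

theorem eq_smul_of_wedge_eq_zero {u r : Plane} (hr : ‖r‖ = 1) (h : wedge u r = 0) :
    u = pairing r u • r := by
  have h1 : r 0 ^ 2 + r 1 ^ 2 = 1 := by rw [← norm_sq_plane, hr, one_pow]
  rw [wedge] at h
  ext x
  fin_cases x
  · simp only [PiLp.smul_apply, smul_eq_mul, pairing, Fin.zero_eta]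
    linear_combination (-u 0) * h1 + r 1 * h
  · simp only [PiLp.smul_apply, smul_eq_mul, pairing, Fin.mk_one]
    linear_combination (-u 1) * h1 - r 0 * h

theorem exists_unit_range {M : Mat2} (hM : M.rank = 1) :
    ∃ r φ : Plane, ‖r‖ = 1 ∧ (∀ v, linMap M v = pairing φ v • r) ∧ ∃ u, linMap M u = r := by
  have hdet : M.det = 0 := by
    by_contra h
    exact not_injective_linMap_of_rank hM (injective_linMap_of_det h)
  obtain ⟨u, hu⟩ : ∃ u, linMap M u ≠ 0 := by
    by_contra! h
    have : M = 0 := by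
      ext x y
      have hy := congrArg (fun v : Plane => v x) (h (EuclideanSpace.single y 1))
      simp only [linMap_apply] at hy
      fin_cases y <;> simpa using hy
    rw [this, Matrix.rank_zero] at hM
    exact zero_ne_one hM
  have hu0 : ‖linMap M u‖ ≠ 0 := norm_ne_zero_iff.2 hu
  set r : Plane := ‖linMap M u‖⁻¹ • linMap M u with hr
  have hr1 : ‖r‖ = 1 := by rw [hr, norm_smul, norm_inv, norm_norm, inv_mul_cancel₀ hu0]
  refine ⟨r, !₂[r 0 * M 0 0 + r 1 * M 1 0, r 0 * M 0 1 + r 1 * M 1 1], hr1, fun v => ?_,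
    ‖linMap M u‖⁻¹ • u, by rw [map_smul]⟩
  have hw : wedge (linMap M v) r = 0 := by
    have : r = linMap M (‖linMap M u‖⁻¹ • u) := by rw [map_smul]
    rw [this, wedge_linMap, hdet, zero_mul]
  conv_lhs => rw [eq_smul_of_wedge_eq_zero hr1 hw]
  congr 1
  simp [pairing, linMap_apply]
  ring

/-- The transversality condition in `MStar`. -/
theorem pairing_ne_zero {M N : Mat2} {r r' φ : Plane} (hr : ‖r‖ = 1) (hr' : ‖r'‖ = 1)
    {ψ : Plane} (hM : ∀ v, linMap M v = pairing ψ v • r) (hMr : ∃ u, linMap M u = r)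
    (hN : ∀ v, linMap N v = pairing φ v • r') (hNr : ∃ u, linMap N u = r')
    (hne : LinearMap.range (linMap M : Plane →ₗ[ℝ] Plane) ≠
      LinearMap.ker (linMap N : Plane →ₗ[ℝ] Plane)) : pairing φ r ≠ 0 := by
  intro h0
  apply hne
  ext v
  rw [LinearMap.mem_range, LinearMap.mem_ker]
  have hr'0 : r' ≠ 0 := fun h => by simp [h] at hr'
  constructor
  · rintro ⟨y, rfl⟩
    change linMap N (linMap M y) = 0
    rw [hM, map_smul, hN, h0, zero_smul, smul_zero]
  · intro hv
    have hv : linMap N v = 0 := hv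
    rw [hN, smul_eq_zero, or_iff_left hr'0] at hv
    obtain ⟨u, hu⟩ := hMr
    have hφ : φ 0 ≠ 0 ∨ φ 1 ≠ 0 := by
      by_contra! h
      obtain ⟨x, hx⟩ := hNr
      rw [hN] at hx
      apply hr'0
      rw [← hx, pairing, h.1, h.2]
      simp
    have hw : wedge v r = 0 := by
      rw [pairing] at h0 hv
      rcases hφ with h | h
      · refine (mul_eq_zero.1 (?_ : φ 0 * wedge v r = 0)).resolve_left h
        rw [wedge]
        linear_combination r 1 * hv - v 1 * h0
      · refine (mul_eq_zero.1 (?_ : φ 1 * wedge v r = 0)).resolve_left h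
        rw [wedge]
        linear_combination v 0 * h0 - r 0 * hv
    refine ⟨pairing r v • u, ?_⟩
    change linMap M _ = v
    rw [map_smul, hu, ← eq_smul_of_wedge_eq_zero hr hw]

theorem rangeDir_eq_mk {M : Mat2} {r φ : Plane} (hr0 : r ≠ 0)
    (hM : ∀ v, linMap M v = pairing φ v • r) (hMr : ∃ u, linMap M u = r) :
    rangeDir M = Projectivization.mk ℝ r hr0 := by
  have hex : ∃ u : Plane, linMap M u ≠ 0 := by
    obtain ⟨u, hu⟩ := hMr
    exact ⟨u, hu ▸ hr0⟩
  rw [rangeDir, dif_pos hex, Projectivization.mk_eq_mk_iff']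
  exact ⟨_, (hM _).symm⟩

/-! ### Almost every point of the family of stationary measures lies on an orbit -/

/-- The quadratic coordinates of the projective line. -/
noncomputable def quadCoord (x y : Fin 2) (v : P1) : ℝ := v.rep x * v.rep y / ‖v.rep‖ ^ 2

theorem measurable_quadCoord (x y : Fin 2) : Measurable (quadCoord x y) := by
  have h : (quadCoord x y) ∘ Projectivization.mk' ℝ =
      fun v : {v : Plane // v ≠ 0} => v.1 x * v.1 y / ‖v.1‖ ^ 2 := by
    funext v
    obtain ⟨a, ha⟩ := Projectivization.exists_smul_eq_mk_rep ℝ v.1 v.2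
    have ha0 : (a : ℝ) ≠ 0 := a.ne_zero
    have hrep : (Projectivization.mk' ℝ v : P1).rep = (a : ℝ) • v.1 := ha.symm
    have hv : ‖v.1‖ ≠ 0 := norm_ne_zero_iff.2 v.2
    simp only [Function.comp, quadCoord, hrep, PiLp.smul_apply, smul_eq_mul, norm_smul, mul_pow,
      Real.norm_eq_abs, sq_abs]
    field_simp
  have hm : Measurable fun v : {v : Plane // v ≠ 0} => v.1 x * v.1 y / ‖v.1‖ ^ 2 := by
    have hx : ∀ z : Fin 2, Measurable fun v : {v : Plane // v ≠ 0} => v.1 z := fun z =>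
      ((PiLp.continuous_apply 2 _ z).comp continuous_subtype_val).measurable
    exact ((hx x).mul (hx y)).div (measurable_subtype_coe.norm.pow_const 2)
  intro s hs
  change MeasurableSet (Projectivization.mk' ℝ ⁻¹' (quadCoord x y ⁻¹' s))
  rw [← preimage_comp, h]
  exact hm hs

/-- The squared sine of the angle between `u` and `v`, times `‖u‖ ^ 2`. -/
noncomputable def sinSq (u : Plane) (v : P1) : ℝ :=
  u 0 ^ 2 * quadCoord 1 1 v - 2 * (u 0 * u 1) * quadCoord 0 1 v + u 1 ^ 2 * quadCoord 0 0 v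

theorem sinSq_eq (u : Plane) (v : P1) : sinSq u v = wedge u v.rep ^ 2 / ‖v.rep‖ ^ 2 := by
  rw [sinSq, quadCoord, quadCoord, quadCoord, wedge]; ring

theorem exists_smul_rep_of_sinSq {u : Plane} (hu : u ≠ 0) {v : P1} (h : sinSq u v = 0) :
    ∃ a : ℝ, u = a • v.rep ∧ a ≠ 0 := by
  have hv : ‖v.rep‖ ≠ 0 := norm_ne_zero_iff.2 v.rep_nonzero
  rw [sinSq_eq, div_eq_zero_iff, or_iff_left (pow_ne_zero 2 hv), pow_eq_zero_iff two_ne_zero] at h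
  have h1 : ‖‖v.rep‖⁻¹ • v.rep‖ = 1 := by
    rw [norm_smul, norm_inv, norm_norm, inv_mul_cancel₀ hv]
  have h2 : wedge u (‖v.rep‖⁻¹ • v.rep) = 0 := by
    simp only [wedge, PiLp.smul_apply, smul_eq_mul] at h ⊢
    linear_combination ‖v.rep‖⁻¹ * h
  have h3 := eq_smul_of_wedge_eq_zero h1 h2
  rw [smul_smul] at h3
  exact ⟨_, h3, fun h0 => hu (by rw [h3, h0, zero_smul])⟩

theorem sinSq_mk {u : Plane} (hu : u ≠ 0) : sinSq u (Projectivization.mk ℝ u hu) = 0 := by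
  obtain ⟨a, ha⟩ := Projectivization.exists_smul_eq_mk_rep ℝ u hu
  have hrep : (Projectivization.mk ℝ u hu : P1).rep = (a : ℝ) • u := ha.symm
  have : wedge u ((a : ℝ) • u) = 0 := by
    simp only [wedge, PiLp.smul_apply, smul_eq_mul]; ring
  rw [sinSq_eq, hrep, this]; simp

theorem measurable_sinSq {u : ℝ → Plane} (hu : Continuous u) :
    Measurable fun x : ℝ × P1 => sinSq (u x.1) x.2 := by
  have hux : ∀ z : Fin 2, Measurable fun x : ℝ × P1 => u x.1 z := fun z =>
    ((PiLp.continuous_apply 2 _ z).comp hu).measurable.comp measurable_fst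
  have hq : ∀ z z' : Fin 2, Measurable fun x : ℝ × P1 => quadCoord z z' x.2 := fun z z' =>
    (measurable_quadCoord z z').comp measurable_snd
  exact ((((hux 0).pow_const 2).mul (hq 1 1)).sub
    ((((hux 0).mul (hux 1)).const_mul 2).mul (hq 0 1))).add
    (((hux 1).pow_const 2).mul (hq 0 0))

theorem linMap_wordProd_injective' {B : Fin k → Mat2} {S : Finset (Fin k)}
    (hI : ∀ j ∉ S, Function.Injective (linMap (B j))) {n : ℕ} {w : Fin n → Fin k}
    (hw : ∀ j, w j ∉ S) : Function.Injective (linMap (wordProd B n w)) :=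
  linMap_wordProd_injective hI n fun j => ⟨w j, hw j⟩

/-- A property of almost every parameter holds at almost every point of `etaTilde`, and the
second coordinate of such a point is on the orbit of a singular range. -/
theorem ae_etaTilde {p : PMF (Fin k)} {S : Finset (Fin k)} {A : ℝ → Fin k → Mat2} {a b : ℝ}
    (hab : a ≤ b) (hM : ∀ t ∈ Icc a b, A t ∈ MStar S)
    (hcont : ∀ i x y, ContinuousOn (fun t => A t i x y) (Icc a b))
    (hconst : ∀ i ∈ S, ∀ t ∈ Icc a b, ∀ t' ∈ Icc a b, A t i = A t' i)
    {r φ : Fin k → Plane} (hr : ∀ i ∈ S, ‖r i‖ = 1)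
    (hA : ∀ t ∈ Icc a b, ∀ i ∈ S, ∀ v, linMap (A t i) v = pairing (φ i) v • r i)
    (hAr : ∀ t ∈ Icc a b, ∀ i ∈ S, ∃ u, linMap (A t i) u = r i)
    {P : ℝ → Prop} (hP : ∀ᵐ t ∂(volume.restrict (Icc a b)), P t) :
    ∀ᵐ x ∂(etaTilde p S A a b), P x.1 ∧ ∃ i ∈ S, ∃ (n : ℕ) (w : Fin n → Fin k),
      (∀ j, w j ∉ S) ∧ ∃ c : ℝ, linMap (wordProd (A x.1) n w) (r i) = c • x.2.rep ∧ c ≠ 0 := by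
  have hI : ∀ t ∈ Icc a b, ∀ j ∉ S, Function.Injective (linMap (A t j)) := fun t ht j hj =>
    injective_linMap_of_det ((hM t ht).2.1 j hj).ne'
  have hr0 : ∀ i ∈ S, r i ≠ 0 := fun i hi h => by simpa [h] using hr i hi
  have hu0 : ∀ t ∈ Icc a b, ∀ i ∈ S, ∀ (n : ℕ) (w : Fin n → Fin k), (∀ j, w j ∉ S) →
      linMap (wordProd (A t) n w) (r i) ≠ 0 := by
    intro t ht i hi n w hw h
    exact hr0 i hi (linMap_wordProd_injective' (hI t ht) hw (by rw [h, map_zero]))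
  obtain ⟨N, hN, hNm, hN0⟩ := exists_measurable_superset_of_null (ae_iff.1 hP)
  -- The parametrization, extended continuously to the line.
  set u : (n : ℕ) → (Fin n → Fin k) → Fin k → ℝ → Plane := fun n w i t =>
    linMap (wordProd (A (projIcc a b hab t)) n w) (r i) with hu
  have huc : ∀ n w i, Continuous (u n w i) := by
    intro n w i
    have h1 : ContinuousOn (fun t => linMap (wordProd (A t) n w) (r i)) (Icc a b) :=
      continuousOn_linMap_apply (continuousOn_wordProd
        (fun i => continuousOn_pi.2 fun x => continuousOn_pi.2 fun y => hcont i x y) n w) (r i)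
    exact (continuousOn_iff_continuous_domRestrict.1 h1).comp continuous_projIcc
  have hueq : ∀ n w i, ∀ t ∈ Icc a b, u n w i t = linMap (wordProd (A t) n w) (r i) := by
    intro n w i t ht
    simp only [hu, projIcc_of_mem hab ht]
  set E : Set (ℝ × P1) := {x | x.1 ∈ Icc a b ∧ x.1 ∉ N} ∩
    ⋃ (n : ℕ) (w : {w : Fin n → Fin k // ∀ j, w j ∉ S}) (i : {i // i ∈ S}),
      {x | sinSq (u n w i x.1) x.2 = 0} with hE
  have hEm : MeasurableSet E := by
    refine MeasurableSet.inter ?_ (MeasurableSet.iUnion fun n => MeasurableSet.iUnion fun w =>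
      MeasurableSet.iUnion fun i => measurableSet_eq_fun (measurable_sinSq (huc _ _ _))
        measurable_const)
    exact (measurable_fst measurableSet_Icc).inter (measurable_fst hNm.compl)
  have hnull : etaTilde p S A a b Eᶜ = 0 := by
    rw [etaTilde_apply hM hcont hconst hEm.compl]
    have hN' : ∀ᵐ t ∂(volume.restrict (Icc a b)), t ∉ N := measure_eq_zero_iff_ae_notMem.1 hN0
    have hz : ∀ᵐ t ∂(volume.restrict (Icc a b)),
        stationaryMeasure p S (A t) (Prod.mk t ⁻¹' Eᶜ) = 0 := by
      filter_upwards [ae_restrict_mem measurableSet_Icc, hN'] with t ht htN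
      have hm : MeasurableSet (Prod.mk t ⁻¹' Eᶜ) := measurable_prodMk_left hEm.compl
      rw [stationaryMeasure_apply p S (A t) hm, ENNReal.tsum_eq_zero]
      intro n
      rw [layer_apply p S (A t) n hm]
      refine Finset.sum_eq_zero fun i hi => Finset.sum_eq_zero fun w _ => ?_
      rw [indicator_of_notMem, mul_zero]
      have hinj := linMap_wordProd_injective (hI t ht) n w
      rw [rangeDir_eq_mk (hr0 i hi) (hA t ht i hi) (hAr t ht i hi), projAct, dif_pos hinj,
        Projectivization.map_mk, mem_preimage, mem_compl_iff, not_not]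
      refine ⟨⟨ht, htN⟩, ?_⟩
      simp only [mem_iUnion, mem_ofPred_eq]
      refine ⟨n, ⟨fun j => (w j : Fin k), fun j => (w j).2⟩, ⟨i, hi⟩, ?_⟩
      rw [hueq _ _ _ _ ht]
      exact sinSq_mk _
    rw [lintegral_congr_ae hz, lintegral_zero]
  have hae : ∀ᵐ x ∂(etaTilde p S A a b), x ∈ E := by
    rw [ae_iff]; exact hnull
  filter_upwards [hae] with x hx
  obtain ⟨⟨ht, htN⟩, hx⟩ := hx
  simp only [mem_iUnion, mem_ofPred_eq] at hx
  obtain ⟨n, w, i, hx⟩ := hx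
  rw [hueq _ _ _ _ ht] at hx
  refine ⟨by_contra fun h => htN (hN h), i, i.2, n, w, w.2, ?_⟩
  exact exists_smul_rep_of_sinSq (hu0 _ ht i i.2 n w w.2) hx

/-! ### Uniform bounds over the parameter interval -/

theorem exists_linMap_bound {M : ℝ → Mat2} {a b : ℝ} (hM : ContinuousOn M (Icc a b)) :
    ∃ C : ℝ, ∀ t ∈ Icc a b, ∀ u, ‖linMap (M t) u‖ ≤ C * ‖u‖ := by
  obtain ⟨C, hC⟩ := isCompact_Icc.exists_bound_of_continuousOn
    (continuous_linMap.comp_continuousOn hM)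
  exact ⟨C, fun t ht u => (linMap (M t)).le_of_opNorm_le (hC t ht) u⟩

theorem exists_linMap_lower_bound {M : ℝ → Mat2} {a b : ℝ} (hM : ContinuousOn M (Icc a b))
    (hdet : ∀ t ∈ Icc a b, (M t).det ≠ 0) :
    ∃ C : ℝ, ∀ t ∈ Icc a b, ∀ u, ‖u‖ ≤ C * ‖linMap (M t) u‖ := by
  have h1 : ContinuousOn (fun t => (M t).det) (Icc a b) :=
    (continuous_id.matrix_det).comp_continuousOn hM
  have h2 : ContinuousOn (fun t => (M t).adjugate) (Icc a b) :=
    (continuous_id.matrix_adjugate).comp_continuousOn hM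
  obtain ⟨C, hC⟩ := exists_linMap_bound ((h1.inv₀ hdet).smul h2)
  refine ⟨C, fun t ht u => ?_⟩
  have h3 : linMap ((M t).det⁻¹ • (M t).adjugate) (linMap (M t) u) = u := by
    rw [← linMap_mul, Matrix.smul_mul, Matrix.adjugate_mul, smul_smul,
      inv_mul_cancel₀ (hdet t ht), one_smul, linMap_one]
  calc ‖u‖ = ‖linMap ((M t).det⁻¹ • (M t).adjugate) (linMap (M t) u)‖ := by rw [h3]
    _ ≤ _ := hC t ht _

end RandomCocycle

/-! ### Large deviations for the family -/

theorem theorem3 {k : ℕ} (p : PMF (Fin k)) (hp : ∀ i, 0 < p i)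
    (S : Finset (Fin k)) (hsing : ∃ i, i ∈ S) (hinv : ∃ j, j ∉ S)
    (a b : ℝ) (hab : a < b)
    (A : ℝ → Fin k → Mat2)
    (hM : ∀ t ∈ Icc a b, A t ∈ MStar S)
    (hsmooth : ∀ i x y, ContDiffOn ℝ ((⊤ : ℕ∞) : WithTop ℕ∞) (fun t => A t i x y) (Icc a b))
    (hconst : ∀ i ∈ S, ∀ t ∈ Icc a b, ∀ t' ∈ Icc a b, A t i = A t' i)
    (hwind : ∃ κ > 0, ∀ t ∈ Icc a b, ∀ j ∉ S, ∀ v : Plane, v ≠ 0 →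
      κ ≤ wedge (linMap (A t j) v)
            (linMap (Matrix.of fun x y => derivWithin (fun s => A s j x y) (Icc a b) t) v)
          / ‖linMap (A t j) v‖ ^ 2) :
    ∃ c₀ : ℝ → ℝ, (∀ ε > 0, 0 < c₀ ε) ∧
      (∀ ε > 0, ∀ᵐ x ∂(etaTilde p S A a b), ∃ n₀ : ℕ, ∀ n ≥ n₀,
        bernoulliMeasure p
            {ω | ENNReal.ofReal ε <
              (vectorGrowth (A x.1) n ω x.2 - topLyapunov p (A x.1)).abs}
          < ENNReal.ofReal (Real.exp (-(c₀ ε * (n : ℝ) ^ (1 / 3 : ℝ))))) ∧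
      (∀ᵐ t ∂(volume.restrict (Icc a b)), ∀ ε > 0, ∃ n₀ : ℕ, ∀ n ≥ n₀,
        bernoulliMeasure p
            {ω | ENNReal.ofReal ε < (normGrowth (A t) n ω - topLyapunov p (A t)).abs}
          < ENNReal.ofReal (Real.exp (-(c₀ ε * (n : ℝ) ^ (1 / 3 : ℝ))))) := by
  obtain ⟨κ, hκ, hwind⟩ := hwind
  set dA : ℝ → Fin k → Mat2 := fun t j =>
    Matrix.of fun x y => derivWithin (fun s => A s j x y) (Icc a b) t with hdA
  have hcont : ∀ i x y, ContinuousOn (fun t => A t i x y) (Icc a b) := fun i x y =>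
    (hsmooth i x y).continuousOn
  have hc : ∀ i, ContinuousOn (fun t => A t i) (Icc a b) := fun i =>
    continuousOn_pi.2 fun x => continuousOn_pi.2 fun y => hcont i x y
  have hdc : ∀ i, ContinuousOn (fun t => dA t i) (Icc a b) := fun i =>
    continuousOn_pi.2 fun x => continuousOn_pi.2 fun y =>
      (hsmooth i x y).continuousOn_derivWithin (uniqueDiffOn_Icc hab) (by simp)
  have hd : ∀ t ∈ Ioo a b, ∀ i x y, HasDerivAt (fun s => A s i x y) (dA t i x y) t :=
    fun t ht i x y => ((((hsmooth i x y).differentiableOn (by simp)) t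
      (Ioo_subset_Icc_self ht)).hasDerivWithinAt).hasDerivAt (Icc_mem_nhds ht.1 ht.2)
  have hdet : ∀ t ∈ Icc a b, ∀ j ∉ S, 0 < (A t j).det := fun t ht => (hM t ht).2.1
  have hw : ∀ t ∈ Icc a b, ∀ j ∉ S, ∀ v, κ * ‖linMap (A t j) v‖ ^ 2 ≤
      wedge (linMap (A t j) v) (linMap (dA t j) v) := by
    intro t ht j hj v
    rcases eq_or_ne v 0 with rfl | hv
    · simp [wedge]
    · have h0 : linMap (A t j) v ≠ 0 := fun h =>
        hv (injective_linMap_of_det (hdet t ht j hj).ne' (by rw [h, map_zero]))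
      have h1 : 0 < ‖linMap (A t j) v‖ ^ 2 := by positivity
      exact (le_div_iff₀ h1).1 (hwind t ht j hj v hv)
  -- A common bound for the distortion of lengths.
  choose C₁ hC₁ using fun i => exists_linMap_bound (hc i)
  choose C₂ hC₂ using fun i => exists_linMap_bound (hdc i)
  have h3 : ∀ i, ∃ C : ℝ, i ∉ S → ∀ t ∈ Icc a b, ∀ u, ‖u‖ ≤ C * ‖linMap (A t i) u‖ := by
    intro i
    by_cases hi : i ∈ S
    · exact ⟨0, fun h => absurd hi h⟩
    · obtain ⟨C, hC⟩ := exists_linMap_lower_bound (hc i) fun t ht => (hdet t ht i hi).ne'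
      exact ⟨C, fun _ => hC⟩
  choose C₃ hC₃ using h3
  obtain ⟨D, hD⟩ : ∃ D : ℝ, 1 ≤ D ∧ ∀ i, C₁ i ≤ D ∧ C₂ i ≤ D ∧ C₃ i ≤ D := by
    refine ⟨1 + ∑ i, (|C₁ i| + |C₂ i| + |C₃ i|), le_add_of_nonneg_right (by positivity),
      fun i => ?_⟩
    have h := Finset.single_le_sum (f := fun i => |C₁ i| + |C₂ i| + |C₃ i|)
      (fun _ _ => by positivity) (Finset.mem_univ i)
    have h1 := le_abs_self (C₁ i)
    have h2 := le_abs_self (C₂ i)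
    have h3 := le_abs_self (C₃ i)
    have := abs_nonneg (C₁ i)
    have := abs_nonneg (C₂ i)
    have := abs_nonneg (C₃ i)
    refine ⟨?_, ?_, ?_⟩ <;> linarith
  obtain ⟨hD1, hD⟩ := hD
  have hup : ∀ t ∈ Icc a b, ∀ i u, ‖linMap (A t i) u‖ ≤ D * ‖u‖ := fun t ht i u =>
    (hC₁ i t ht u).trans (mul_le_mul_of_nonneg_right (hD i).1 (norm_nonneg _))
  have hdup : ∀ t ∈ Icc a b, ∀ i u, ‖linMap (dA t i) u‖ ≤ D * ‖u‖ := fun t ht i u =>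
    (hC₂ i t ht u).trans (mul_le_mul_of_nonneg_right (hD i).2.1 (norm_nonneg _))
  have hlow : ∀ t ∈ Icc a b, ∀ j ∉ S, ∀ u, ‖u‖ ≤ D * ‖linMap (A t j) u‖ := fun t ht j hj u =>
    (hC₃ j hj t ht u).trans (mul_le_mul_of_nonneg_right (hD j).2.2 (norm_nonneg _))
  -- Unit vectors spanning the ranges of the singular letters.
  have ha : a ∈ Icc a b := left_mem_Icc.2 hab.le
  choose! r φ hr hAa hAra using fun i (hi : i ∈ S) => exists_unit_range ((hM a ha).1 i hi)
  have hA : ∀ t ∈ Icc a b, ∀ i ∈ S, ∀ v, linMap (A t i) v = pairing (φ i) v • r i :=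
    fun t ht i hi => hconst i hi a ha t ht ▸ hAa i hi
  have hAr : ∀ t ∈ Icc a b, ∀ i ∈ S, ∃ u, linMap (A t i) u = r i :=
    fun t ht i hi => hconst i hi a ha t ht ▸ hAra i hi
  have hφr : ∀ i ∈ S, ∀ j ∈ S, pairing (φ j) (r i) ≠ 0 := fun i hi j hj =>
    pairing_ne_zero (hr i hi) (hr j hj) (hAa i hi) (hAra i hi) (hAa j hj) (hAra j hj)
      ((hM a ha).2.2 i hi j hj)
  obtain ⟨α, hα, hmom⟩ := exists_ae_lintegral_image_ne_top hp hsing hab.le hD1 hκ hc hd hup hdup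
    hlow hdet hw hr hA hφr
  have hae := (hmom.and (ae_restrict_mem measurableSet_Icc)).mono fun t ht =>
    exists_lyapunov_decaysExp hp hsing hD1 (hup t ht.2) (hlow t ht.2) hr
      (fun i hi u => ⟨_, hA t ht.2 i hi u⟩) hα ht.1
  -- For fixed `t` the decay is exponential, with a rate depending on `t`; it beats
  -- `exp (-n ^ (1/3))` for large `n`, so `1` is a uniform choice of the constant.
  refine ⟨fun _ => 1, fun _ _ => one_pos, fun ε hε => ?_, ?_⟩
  · filter_upwards [ae_etaTilde (p := p) hab.le hM hcont hconst hr hA hAr hae] with x hx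
    obtain ⟨⟨-, hx⟩, i, hi, m, w, hwS, c, hc, hc0⟩ := hx
    exact (hx ε hε i hi m w hwS x.2 c hc hc0).exists_lt
  · filter_upwards [hae] with t ht ε hε
    exact (ht.1 ε hε).exists_lt
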